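/- Let $M=\mathbb{S}^1\times[-\rho,\rho]$, $\rho>0$, and let $g_0$ be a Riemannian metric on $M$, smooth up to the boundary, with scalar curvature $R_{g_0}\ge 0$ on $M$ and geodesic curvature $k_{g_0}\le 0$ on $\partial M$ (with the sign for which a round disc in the plane has positive boundary curvature). By the unnormalised Ricci flow starting at $g_0$ on $[0,\tilde T)$, $0<\tilde T\le\infty$, we mean a family of metrics $\tilde g(\tilde t)$ on $M$ with $$\frac{\partial\tilde g}{\partial\tilde t}=-R_{\tilde g}\,\tilde g\ \text{ in } M\times(0,\tilde T),\qquad k_{\tilde g}=k_{g_0}\ \text{ on }\partial M\times(0,\tilde T),\qquad \tilde g(0)=g_0,$$ which is smooth on $M\times(0,\tilde T)$ (up to $\partial M$) and continuous together with its space derivatives of order at most two on $M\times[0,\tilde T)$. The corresponding normalised flow is $g(t)=\phi(\tilde t)\,\tilde g(\tilde t)$, where $\phi(\tilde t)=1/A_{\tilde g(\tilde t)}(M)$, so that $g(t)$ has area $1$, and $t=t(\tilde t)=\int_0^{\tilde t}\phi(\tau)\,d\tau$; it is defined on the interval $[0,T)$, $0<T\le\infty$, onto which $\tilde t\mapsto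 t(\tilde t)$ maps $[0,\tilde T)$. Then there is a constant $c>0$, depending only on $M$ and $g_0$ and in particular independent of time, such that every such normalised flow starting at $g_0$, on any interval $[0,T)$, satisfies $$\int_M R_{g(t)}\,dA_{g(t)}\le\frac{c}{\log(t+1)}\qquad\text{for all } t\in(0,T).$$ -/

import Mathlib

open scoped ContDiff

noncomputable section

namespace CylinderFlow

/-- The universal cover `ℝ × [-ρ, ρ]` of the cylinder `𝕊¹ × [-ρ, ρ]`, `𝕊¹ = ℝ / 2πℤ`, with
coordinates `(θ, s)`. Tensors on the cylinder are tensors on this strip that are `2π`-periodic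
in `θ`. -/
def strip (ρ : ℝ) : Set (ℝ × ℝ) := Set.univ ×ˢ Set.Icc (-ρ) ρ

/-- The boundary `s = ±ρ` of the strip. -/
def stripBoundary (ρ : ℝ) : Set (ℝ × ℝ) := {p | p.2 = -ρ ∨ p.2 = ρ}

/-- A field of `2 × 2` matrices: the components `g_{ij}` of a symmetric 2-tensor in the
coordinates `x⁰ = θ`, `x¹ = s`. Only the values on the strip matter. -/
abbrev TensorField := ℝ × ℝ → Matrix (Fin 2) (Fin 2) ℝ

/-- `g` is a smooth (up to the boundary) Riemannian metric on the cylinder. -/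
structure IsSmoothMetric (ρ : ℝ) (g : TensorField) : Prop where
  smooth : ∀ i j, ContDiffOn ℝ ∞ (fun p => g p i j) (strip ρ)
  periodic : ∀ θ s, s ∈ Set.Icc (-ρ) ρ → g (θ + 2 * Real.pi, s) = g (θ, s)
  posDef : ∀ p ∈ strip ρ, (g p).PosDef

/-- The coordinate vectors `∂₀ = ∂/∂θ` and `∂₁ = ∂/∂s`. -/
def coordVec : Fin 2 → ℝ × ℝ := ![(1, 0), (0, 1)]

/-- The partial derivative `∂ᵢ f` (one-sided in `s` on the boundary). -/
def pderiv (ρ : ℝ) (i : Fin 2) (f : ℝ × ℝ → ℝ) (p : ℝ × ℝ) : ℝ :=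
  fderivWithin ℝ f (strip ρ) p (coordVec i)

/-- The Christoffel symbol
`Γᵏᵢⱼ = ½ gᵏˡ (∂ᵢ g_{lj} + ∂ⱼ g_{il} - ∂ₗ g_{ij})` of the Levi-Civita connection. -/
def christoffel (ρ : ℝ) (g : TensorField) (k i j : Fin 2) (p : ℝ × ℝ) : ℝ :=
  1 / 2 * ∑ l, (g p)⁻¹ k l *
    (pderiv ρ i (fun q => g q l j) p + pderiv ρ j (fun q => g q i l) p
      - pderiv ρ l (fun q => g q i j) p)

/-- The Ricci tensor
`Ric_{jk} = ∂ᵢ Γⁱⱼₖ - ∂ⱼ Γⁱᵢₖ + Γⁱᵢₗ Γˡⱼₖ - Γⁱⱼₗ Γˡᵢₖ`. -/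
def ricci (ρ : ℝ) (g : TensorField) (j k : Fin 2) (p : ℝ × ℝ) : ℝ :=
  ∑ i, (pderiv ρ i (christoffel ρ g i j k) p - pderiv ρ j (christoffel ρ g i i k) p
    + ∑ l, (christoffel ρ g i i l p * christoffel ρ g l j k p
      - christoffel ρ g i j l p * christoffel ρ g l i k p))

/-- The scalar curvature `R = gʲᵏ Ric_{jk}` (twice the Gauss curvature). -/
def scalarCurvature (ρ : ℝ) (g : TensorField) (p : ℝ × ℝ) : ℝ :=
  ∑ j, ∑ k, (g p)⁻¹ j k * ricci ρ g j k p

/-- The outward unit normal at a boundary point: `± grad s / |grad s|` at `s = ±ρ`. -/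
def outwardNormal (g : TensorField) (p : ℝ × ℝ) (l : Fin 2) : ℝ :=
  Real.sign p.2 * (g p)⁻¹ l 1 / Real.sqrt ((g p)⁻¹ 1 1)

/-- The geodesic curvature of the boundary at a boundary point,
`k_g = - ⟨∇_{∂θ} ∂θ, ν⟩ / ⟨∂θ, ∂θ⟩` with `ν` the outward unit normal; it is `-⟨∇_T T, ν⟩` for the
unit tangent `T`, so that a round disc in the plane has positive boundary curvature. -/
def geodesicCurvature (ρ : ℝ) (g : TensorField) (p : ℝ × ℝ) : ℝ :=
  -(∑ k, ∑ l, g p k l * christoffel ρ g k 0 0 p * outwardNormal g p l) / g p 0 0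

/-- The integral of `f` over the cylinder against the area element `dA_g = √(det g) ds dθ`. -/
def integralM (ρ : ℝ) (g : TensorField) (f : ℝ × ℝ → ℝ) : ℝ :=
  ∫ θ in (0 : ℝ)..(2 * Real.pi), ∫ s in (-ρ)..ρ, f (θ, s) * Real.sqrt (g (θ, s)).det

/-- The area `A_g(M)`. -/
def area (ρ : ℝ) (g : TensorField) : ℝ := integralM ρ g (fun _ => 1)

/-- The total scalar curvature `∫_M R dA_g`. -/
def totalScalarCurvature (ρ : ℝ) (g : TensorField) : ℝ :=
  integralM ρ g (scalarCurvature ρ g)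

/-- `g` is a solution on `M × [0, T)`, `0 < T ≤ ∞`, of the unnormalised flow
`∂g/∂t = -R g` in `M × (0, T)`, `k_g = k_{g₀}` on `∂M × (0, T)`, `g(0) = g₀`.
The solution is smooth up to the boundary of `M` at positive times, and `g` and its space
derivatives of order at most two are continuous down to `t = 0`. -/
structure IsRicciFlow (ρ : ℝ) (g₀ : TensorField) (T : EReal) (g : ℝ → TensorField) : Prop where
  pos : 0 < T
  smooth : ∀ i j, ContDiffOn ℝ ∞ (fun q : ℝ × (ℝ × ℝ) => g q.1 q.2 i j)
    ({t : ℝ | 0 < t ∧ (t : EReal) < T} ×ˢ strip ρ)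
  continuous₀ : ∀ i j, ContinuousOn (fun q : ℝ × (ℝ × ℝ) => g q.1 q.2 i j)
    ({t : ℝ | 0 ≤ t ∧ (t : EReal) < T} ×ˢ strip ρ)
  continuous₁ : ∀ i j a, ContinuousOn
    (fun q : ℝ × (ℝ × ℝ) => pderiv ρ a (fun p => g q.1 p i j) q.2)
    ({t : ℝ | 0 ≤ t ∧ (t : EReal) < T} ×ˢ strip ρ)
  continuous₂ : ∀ i j a b, ContinuousOn
    (fun q : ℝ × (ℝ × ℝ) => pderiv ρ a (pderiv ρ b (fun p => g q.1 p i j)) q.2)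
    ({t : ℝ | 0 ≤ t ∧ (t : EReal) < T} ×ˢ strip ρ)
  metric : ∀ t : ℝ, 0 ≤ t → (t : EReal) < T → IsSmoothMetric ρ (g t)
  evolution : ∀ t : ℝ, 0 < t → (t : EReal) < T → ∀ p ∈ strip ρ, ∀ i j,
    HasDerivAt (fun τ => g τ p i j) (-(scalarCurvature ρ (g t) p) * g t p i j) t
  boundary : ∀ t : ℝ, 0 < t → (t : EReal) < T → ∀ p ∈ stripBoundary ρ,
    geodesicCurvature ρ (g t) p = geodesicCurvature ρ g₀ p
  initial : ∀ p ∈ strip ρ, g 0 p = g₀ p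

/-- The factor `φ = 1 / A_g(M)`, for which `φ g` has area one. -/
def normalisingFactor (ρ : ℝ) (g : TensorField) : ℝ := (area ρ g)⁻¹

/-- The rescaled time `t(τ) = ∫₀^τ φ`, where `φ` belongs to the unnormalised flow `g`. -/
def normalisedTime (ρ : ℝ) (g : ℝ → TensorField) (τ : ℝ) : ℝ :=
  ∫ σ in (0 : ℝ)..τ, normalisingFactor ρ (g σ)

/-- `g` is, on `[0, T)`, the normalised flow obtained from a solution `g'` of the
unnormalised flow with initial metric `g₀` on a time interval `[0, T')`: the map `τ ↦ t(τ)` takes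
`[0, T')` onto `[0, T)`, and `g(t(τ)) = φ(τ) g'(τ)`. -/
def IsNormalisedRicciFlow (ρ : ℝ) (g₀ : TensorField) (T : EReal) (g : ℝ → TensorField) : Prop :=
  ∃ (T' : EReal) (g' : ℝ → TensorField), IsRicciFlow ρ g₀ T' g' ∧
    (∀ τ : ℝ, 0 ≤ τ → (τ : EReal) < T' → (normalisedTime ρ g' τ : EReal) < T ∧
      ∀ p ∈ strip ρ, g (normalisedTime ρ g' τ) p = normalisingFactor ρ (g' τ) • g' τ p) ∧
    (∀ t : ℝ, 0 ≤ t → (t : EReal) < T →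
      ∃ τ : ℝ, 0 ≤ τ ∧ (τ : EReal) < T' ∧ normalisedTime ρ g' τ = t)

end CylinderFlow

end

noncomputable section

namespace CylinderFlow

/-! The flow stays in the conformal class of `g₀`: `g(τ) = eʷ g₀` with `w = log g(τ)₀₀ - log
(g₀)₀₀`. Write `F` for the total scalar curvature and `A` for the area of the unnormalised flow. `F`
is scale invariant, so it suffices to bound `F` in the rescaled time `t`.

The maximum principle gives `w ≤ 0` from `R ≥ 0` and `k ≤ 0` at the initial time. Comparing the flow
with its own time shifts then shows that the metric decreases (`log_antitone`), and since `R = -∂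
log g₀₀` this yields `R ≥ 0` at positive times without using the evolution equation of `R`. At a
positive maximum of `w` on the boundary, the sign of `k` forces the gradient to vanish, so no Hopf
lemma is needed (`scalarCurvature_le_of_max`).

The cylinder has Euler characteristic zero, so Gauss–Bonnet reads `F = -2 ∫ k`. As `k` is prescribed
and lengths shrink, `F` is nonincreasing in time. Since `dA/dτ = -F` and `dt/dτ = 1/A`, one has `d
log A / dt = -F`, whence `A ≤ A₀ exp(-F t)` with `F` evaluated at the final time (`area_le`).

Conversely `F` is controlled by the area: `F ≤ C A^(1/4)` with `C` depending on `g₀` alone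
(`exists_totalScalarCurvature_le`). This rests on the energy bound `∫ e^(w/2) |∇w|² ≤ 2 F(g₀)`,
obtained by testing the equation for `Δw` against `1 - e^(w/2)`, and on a trace estimate for
`e^(w/2)`. Together, `F exp(F t / 4) ≤ C A₀^(1/4)`, which forces decay of `F` at least as fast as `1
/ log(t + 1)`. -/

lemma convex_strip (ρ : ℝ) : Convex ℝ (strip ρ) := convex_univ.prod (convex_Icc _ _)

lemma interior_strip (ρ : ℝ) : interior (strip ρ) = Set.univ ×ˢ Set.Ioo (-ρ) ρ := by
  rw [strip, interior_prod_eq, interior_univ, interior_Icc]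

lemma interior_strip_nonempty {ρ : ℝ} (hρ : 0 < ρ) : (interior (strip ρ)).Nonempty := by
  rw [interior_strip]
  exact ⟨(0, 0), trivial, by simpa using hρ⟩

lemma uniqueDiffOn_strip {ρ : ℝ} (hρ : 0 < ρ) : UniqueDiffOn ℝ (strip ρ) :=
  uniqueDiffOn_convex (convex_strip ρ) (interior_strip_nonempty hρ)

lemma strip_subset_closure_interior {ρ : ℝ} (hρ : 0 < ρ) :
    strip ρ ⊆ closure (interior (strip ρ)) := by
  rw [(convex_strip ρ).closure_interior_eq_closure_of_nonempty_interior
    (interior_strip_nonempty hρ)]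
  exact subset_closure

lemma mem_strip {ρ : ℝ} {p : ℝ × ℝ} : p ∈ strip ρ ↔ -ρ ≤ p.2 ∧ p.2 ≤ ρ := by
  simp [strip]

/-! ### Calculus of partial derivatives on the closed strip. -/

/-- `f` has `d` as its `i`-th partial derivative at `p`, within the strip. -/
def HasPD (ρ : ℝ) (i : Fin 2) (f : ℝ × ℝ → ℝ) (p : ℝ × ℝ) (d : ℝ) : Prop :=
  DifferentiableWithinAt ℝ f (strip ρ) p ∧ pderiv ρ i f p = d

lemma pderiv_congr {ρ : ℝ} {i : Fin 2} {f h : ℝ × ℝ → ℝ} (hfh : ∀ q ∈ strip ρ, f q = h q)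
    {p : ℝ × ℝ} (hp : p ∈ strip ρ) : pderiv ρ i f p = pderiv ρ i h p := by
  rw [pderiv, pderiv, fderivWithin_congr hfh (hfh p hp)]

section Rules

variable {ρ : ℝ} {i : Fin 2} {f h : ℝ × ℝ → ℝ} {p : ℝ × ℝ} {a b : ℝ}

lemma HasPD.of_hasFDerivWithinAt (hρ : 0 < ρ) (hp : p ∈ strip ρ) {f' : ℝ × ℝ →L[ℝ] ℝ}
    (hf : HasFDerivWithinAt f f' (strip ρ) p) : HasPD ρ i f p (f' (coordVec i)) :=
  ⟨hf.differentiableWithinAt, by rw [pderiv, hf.fderivWithin (uniqueDiffOn_strip hρ p hp)]⟩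

lemma HasPD.congr (hf : HasPD ρ i f p a) (hp : p ∈ strip ρ) (hfh : ∀ q ∈ strip ρ, h q = f q) :
    HasPD ρ i h p a :=
  ⟨hf.1.congr hfh (hfh p hp), by rw [pderiv_congr hfh hp, hf.2]⟩

lemma HasPD.const (hρ : 0 < ρ) (hp : p ∈ strip ρ) (c : ℝ) : HasPD ρ i (fun _ => c) p 0 := by
  simpa using HasPD.of_hasFDerivWithinAt (i := i) hρ hp (hasFDerivWithinAt_const c p (strip ρ))

lemma HasPD.add (hρ : 0 < ρ) (hp : p ∈ strip ρ) (hf : HasPD ρ i f p a) (hh : HasPD ρ i h p b) :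
    HasPD ρ i (fun q => f q + h q) p (a + b) := by
  have := HasPD.of_hasFDerivWithinAt (i := i) hρ hp
    (hf.1.hasFDerivWithinAt.add hh.1.hasFDerivWithinAt)
  rw [← hf.2, ← hh.2]
  change HasPD ρ i (f + h) p _
  simpa [pderiv] using this

lemma HasPD.neg (hρ : 0 < ρ) (hp : p ∈ strip ρ) (hf : HasPD ρ i f p a) :
    HasPD ρ i (fun q => -f q) p (-a) := by
  have := HasPD.of_hasFDerivWithinAt (i := i) hρ hp hf.1.hasFDerivWithinAt.neg
  rw [← hf.2]
  change HasPD ρ i (-f) p _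
  simpa [pderiv] using this

lemma HasPD.sub (hρ : 0 < ρ) (hp : p ∈ strip ρ) (hf : HasPD ρ i f p a) (hh : HasPD ρ i h p b) :
    HasPD ρ i (fun q => f q - h q) p (a - b) := by
  have := HasPD.of_hasFDerivWithinAt (i := i) hρ hp
    (hf.1.hasFDerivWithinAt.sub hh.1.hasFDerivWithinAt)
  rw [← hf.2, ← hh.2]
  change HasPD ρ i (f - h) p _
  simpa [pderiv] using this

lemma HasPD.mul (hρ : 0 < ρ) (hp : p ∈ strip ρ) (hf : HasPD ρ i f p a) (hh : HasPD ρ i h p b) :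
    HasPD ρ i (fun q => f q * h q) p (a * h p + f p * b) := by
  have := HasPD.of_hasFDerivWithinAt (i := i) hρ hp
    (hf.1.hasFDerivWithinAt.mul hh.1.hasFDerivWithinAt)
  rw [← hf.2, ← hh.2, add_comm]
  change HasPD ρ i (f * h) p _
  simpa [pderiv, mul_comm] using this

lemma HasPD.comp (hρ : 0 < ρ) (hp : p ∈ strip ρ) {φ : ℝ → ℝ} {φ' : ℝ}
    (hφ : HasDerivAt φ φ' (f p)) (hf : HasPD ρ i f p a) :
    HasPD ρ i (fun q => φ (f q)) p (φ' * a) := by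
  have := HasPD.of_hasFDerivWithinAt (i := i) hρ hp
    (hφ.comp_hasFDerivWithinAt p hf.1.hasFDerivWithinAt)
  rw [← hf.2]
  change HasPD ρ i (φ ∘ f) p _
  simpa [pderiv] using this

lemma HasPD.const_mul (hρ : 0 < ρ) (hp : p ∈ strip ρ) (c : ℝ) (hf : HasPD ρ i f p a) :
    HasPD ρ i (fun q => c * f q) p (c * a) := by
  simpa using (HasPD.const hρ hp c).mul hρ hp hf

lemma HasPD.div (hρ : 0 < ρ) (hp : p ∈ strip ρ) (hf : HasPD ρ i f p a) (hh : HasPD ρ i h p b)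
    (h0 : h p ≠ 0) : HasPD ρ i (fun q => f q / h q) p ((a * h p - f p * b) / h p ^ 2) := by
  have := hf.mul hρ hp (HasPD.comp hρ hp (hasDerivAt_inv h0) hh)
  simp only [div_eq_mul_inv]
  convert this using 1
  field_simp
  ring

lemma HasPD.sqrt (hρ : 0 < ρ) (hp : p ∈ strip ρ) (hf : HasPD ρ i f p a) (h0 : 0 < f p) :
    HasPD ρ i (fun q => Real.sqrt (f q)) p (a / (2 * Real.sqrt (f p))) := by
  have := HasPD.comp hρ hp (Real.hasDerivAt_sqrt h0.ne') hf
  convert this using 1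
  ring

lemma HasPD.exp (hρ : 0 < ρ) (hp : p ∈ strip ρ) (hf : HasPD ρ i f p a) :
    HasPD ρ i (fun q => Real.exp (f q)) p (Real.exp (f p) * a) :=
  HasPD.comp hρ hp (Real.hasDerivAt_exp _) hf

end Rules

section Smooth

variable {ρ : ℝ} {f : ℝ × ℝ → ℝ} {p : ℝ × ℝ}

lemma hasPD_of_contDiffOn (hf : ContDiffOn ℝ ∞ f (strip ρ)) (i : Fin 2) (hp : p ∈ strip ρ) :
    HasPD ρ i f p (pderiv ρ i f p) :=
  ⟨hf.differentiableOn (by simp) p hp, rfl⟩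

lemma contDiffOn_pderiv (hρ : 0 < ρ) (hf : ContDiffOn ℝ ∞ f (strip ρ)) (i : Fin 2) :
    ContDiffOn ℝ ∞ (pderiv ρ i f) (strip ρ) :=
  (hf.fderivWithin (uniqueDiffOn_strip hρ) (by simp)).clm_apply contDiffOn_const

lemma fderivWithin_pderiv (hρ : 0 < ρ) (hf : ContDiffOn ℝ ∞ f (strip ρ)) (j : Fin 2)
    (hp : p ∈ strip ρ) (v : ℝ × ℝ) :
    fderivWithin ℝ (pderiv ρ j f) (strip ρ) p v =
      fderivWithin ℝ (fderivWithin ℝ f (strip ρ)) (strip ρ) p v (coordVec j) := by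
  have hd : DifferentiableWithinAt ℝ (fderivWithin ℝ f (strip ρ)) (strip ρ) p :=
    (hf.fderivWithin (uniqueDiffOn_strip hρ) (m := ∞) (by simp)).differentiableOn
      (by simp) p hp
  have := (hd.hasFDerivWithinAt.clm_apply
    (hasFDerivWithinAt_const (coordVec j) p (strip ρ))).fderivWithin (uniqueDiffOn_strip hρ p hp)
  change fderivWithin ℝ (fun q => fderivWithin ℝ f (strip ρ) q (coordVec j)) (strip ρ) p v = _
  rw [this]
  simp

/-- Symmetry persists for one-sided derivatives at the boundary, because every point of the strip is
a limit of interior points. -/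
lemma pderiv_pderiv_comm (hρ : 0 < ρ) (hf : ContDiffOn ℝ ∞ f (strip ρ)) (i j : Fin 2)
    (hp : p ∈ strip ρ) :
    pderiv ρ i (pderiv ρ j f) p = pderiv ρ j (pderiv ρ i f) p := by
  have hs : IsSymmSndFDerivWithinAt ℝ f (strip ρ) p :=
    (hf p hp).isSymmSndFDerivWithinAt
      (by simpa using WithTop.coe_le_coe.2 (le_top (a := (2 : ℕ∞)))) (uniqueDiffOn_strip hρ)
      (strip_subset_closure_interior hρ hp) hp
  rw [pderiv, fderivWithin_pderiv hρ hf j hp, pderiv, fderivWithin_pderiv hρ hf i hp]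
  exact hs.eq _ _

lemma fderivWithin_apply_eq (v : ℝ × ℝ) :
    fderivWithin ℝ f (strip ρ) p v = v.1 * pderiv ρ 0 f p + v.2 * pderiv ρ 1 f p := by
  have hv : v = v.1 • coordVec 0 + v.2 • coordVec 1 := by
    ext <;> simp [coordVec]
  conv_lhs => rw [hv]
  simp [pderiv]

-- Translation by the period maps the strip to itself, so differentiation within the strip commutes
-- with it.
open scoped Pointwise in
lemma pderiv_periodic {i : Fin 2}
    (hf : ∀ θ s, s ∈ Set.Icc (-ρ) ρ → f (θ + 2 * Real.pi, s) = f (θ, s))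
    (θ s : ℝ) (hs : s ∈ Set.Icc (-ρ) ρ) :
    pderiv ρ i f (θ + 2 * Real.pi, s) = pderiv ρ i f (θ, s) := by
  have h1 : ∀ q ∈ strip ρ, (fun q => f (q + (2 * Real.pi, 0))) q = f q := by
    rintro ⟨x, y⟩ hq
    simpa using hf x y hq.2
  have hp : ((θ, s) : ℝ × ℝ) ∈ strip ρ := ⟨trivial, hs⟩
  have h2 := fderivWithin_congr h1 (h1 _ hp) (𝕜 := ℝ)
  have hset : ((2 * Real.pi, 0) : ℝ × ℝ) +ᵥ strip ρ = strip ρ := by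
    ext ⟨x, y⟩
    rw [Set.mem_vadd_set_iff_neg_vadd_mem]
    simp [strip]
  rw [fderivWithin_comp_add_right, hset] at h2
  rw [pderiv, pderiv, ← h2]
  simp

end Smooth

/-! ### Christoffel symbols and curvature in terms of the metric components. -/

namespace IsSmoothMetric

variable {ρ : ℝ} {g : TensorField} (hg : IsSmoothMetric ρ g) {p : ℝ × ℝ} (hp : p ∈ strip ρ)

include hg hp

lemma symm : g p 1 0 = g p 0 1 := by
  simpa using (hg.posDef p hp).1.apply 0 1

lemma det_eq : (g p).det = g p 0 0 * g p 1 1 - g p 0 1 * g p 0 1 := by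
  rw [Matrix.det_fin_two, hg.symm hp]

lemma disc_pos : 0 < g p 0 0 * g p 1 1 - g p 0 1 * g p 0 1 := by
  rw [← hg.det_eq hp]; exact (hg.posDef p hp).det_pos

lemma pos00 : 0 < g p 0 0 := (hg.posDef p hp).diag_pos

lemma pos11 : 0 < g p 1 1 := (hg.posDef p hp).diag_pos

lemma inv00 : (g p)⁻¹ 0 0 = g p 1 1 / (g p 0 0 * g p 1 1 - g p 0 1 * g p 0 1) := by
  rw [Matrix.inv_def, Matrix.adjugate_fin_two, hg.det_eq hp]; simp; ring

lemma inv01 : (g p)⁻¹ 0 1 = -g p 0 1 / (g p 0 0 * g p 1 1 - g p 0 1 * g p 0 1) := by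
  rw [Matrix.inv_def, Matrix.adjugate_fin_two, hg.det_eq hp]; simp; ring

lemma inv10 : (g p)⁻¹ 1 0 = -g p 0 1 / (g p 0 0 * g p 1 1 - g p 0 1 * g p 0 1) := by
  rw [Matrix.inv_def, Matrix.adjugate_fin_two, hg.det_eq hp]; simp [hg.symm hp]; ring

lemma inv11 : (g p)⁻¹ 1 1 = g p 0 0 / (g p 0 0 * g p 1 1 - g p 0 1 * g p 0 1) := by
  rw [Matrix.inv_def, Matrix.adjugate_fin_two, hg.det_eq hp]; simp; ring

lemma pderiv10 (i : Fin 2) : pderiv ρ i (fun q => g q 1 0) p = pderiv ρ i (fun q => g q 0 1) p :=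
  pderiv_congr (fun _ hq => hg.symm hq) hp

lemma christoffel000 : christoffel ρ g 0 0 0 p =
    (g p 1 1 * pderiv ρ 0 (fun q => g q 0 0) p - g p 0 1 *
      (2 * pderiv ρ 0 (fun q => g q 0 1) p - pderiv ρ 1 (fun q => g q 0 0) p)) /
    (2 * (g p 0 0 * g p 1 1 - g p 0 1 * g p 0 1)) := by
  have := (hg.disc_pos hp).ne'
  simp only [christoffel, Fin.sum_univ_two, hg.inv00 hp, hg.inv01 hp, hg.pderiv10 hp]
  field_simp
  ring

lemma christoffel100 : christoffel ρ g 1 0 0 p =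
    (g p 0 0 * (2 * pderiv ρ 0 (fun q => g q 0 1) p - pderiv ρ 1 (fun q => g q 0 0) p)
      - g p 0 1 * pderiv ρ 0 (fun q => g q 0 0) p) /
    (2 * (g p 0 0 * g p 1 1 - g p 0 1 * g p 0 1)) := by
  have := (hg.disc_pos hp).ne'
  simp only [christoffel, Fin.sum_univ_two, hg.inv10 hp, hg.inv11 hp, hg.pderiv10 hp]
  field_simp
  ring

lemma christoffel001 : christoffel ρ g 0 0 1 p =
    (g p 1 1 * pderiv ρ 1 (fun q => g q 0 0) p - g p 0 1 * pderiv ρ 0 (fun q => g q 1 1) p) /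
    (2 * (g p 0 0 * g p 1 1 - g p 0 1 * g p 0 1)) := by
  have := (hg.disc_pos hp).ne'
  simp only [christoffel, Fin.sum_univ_two, hg.inv00 hp, hg.inv01 hp]
  field_simp
  ring

lemma christoffel101 : christoffel ρ g 1 0 1 p =
    (g p 0 0 * pderiv ρ 0 (fun q => g q 1 1) p - g p 0 1 * pderiv ρ 1 (fun q => g q 0 0) p) /
    (2 * (g p 0 0 * g p 1 1 - g p 0 1 * g p 0 1)) := by
  have := (hg.disc_pos hp).ne'
  simp only [christoffel, Fin.sum_univ_two, hg.inv10 hp, hg.inv11 hp]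
  field_simp
  ring

lemma christoffel_k10 (k : Fin 2) : christoffel ρ g k 1 0 p = christoffel ρ g k 0 1 p := by
  simp only [christoffel, Fin.sum_univ_two, hg.pderiv10 hp]
  ring

lemma christoffel011 : christoffel ρ g 0 1 1 p =
    (g p 1 1 * (2 * pderiv ρ 1 (fun q => g q 0 1) p - pderiv ρ 0 (fun q => g q 1 1) p)
      - g p 0 1 * pderiv ρ 1 (fun q => g q 1 1) p) /
    (2 * (g p 0 0 * g p 1 1 - g p 0 1 * g p 0 1)) := by
  have := (hg.disc_pos hp).ne'
  simp only [christoffel, Fin.sum_univ_two, hg.inv00 hp, hg.inv01 hp, hg.pderiv10 hp]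
  field_simp
  ring

lemma christoffel111 : christoffel ρ g 1 1 1 p =
    (g p 0 0 * pderiv ρ 1 (fun q => g q 1 1) p - g p 0 1 *
      (2 * pderiv ρ 1 (fun q => g q 0 1) p - pderiv ρ 0 (fun q => g q 1 1) p)) /
    (2 * (g p 0 0 * g p 1 1 - g p 0 1 * g p 0 1)) := by
  have := (hg.disc_pos hp).ne'
  simp only [christoffel, Fin.sum_univ_two, hg.inv10 hp, hg.inv11 hp, hg.pderiv10 hp]
  field_simp
  ring

end IsSmoothMetric

/-- Each Christoffel symbol has the shape `(xX - yY) / (2 det g)`, so this one quotient rule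
differentiates all of them. -/
lemma hasPD_quotient {ρ : ℝ} (hρ : 0 < ρ) {p : ℝ × ℝ} (hp : p ∈ strip ρ) {i : Fin 2}
    {E F G x X y Y : ℝ × ℝ → ℝ} {E' F' G' x' X' y' Y' : ℝ}
    (hE : HasPD ρ i E p E') (hF : HasPD ρ i F p F') (hG : HasPD ρ i G p G')
    (hx : HasPD ρ i x p x') (hX : HasPD ρ i X p X') (hy : HasPD ρ i y p y')
    (hY : HasPD ρ i Y p Y') (hD : 0 < E p * G p - F p * F p) :
    HasPD ρ i (fun q => (x q * X q - y q * Y q) / (2 * (E q * G q - F q * F q))) p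
      (((x' * X p + x p * X' - (y' * Y p + y p * Y')) * (E p * G p - F p * F p) -
        (x p * X p - y p * Y p) * (E' * G p + E p * G' - 2 * F p * F')) /
        (2 * (E p * G p - F p * F p) ^ 2)) := by
  have := ((hx.mul hρ hp hX).sub hρ hp (hy.mul hρ hp hY)).div hρ hp
    (((hE.mul hρ hp hG).sub hρ hp (hF.mul hρ hp hF)).const_mul hρ hp 2) (by positivity)
  convert this using 1
  have h := hD.ne'
  field_simp
  ring

namespace IsSmoothMetric

variable {ρ : ℝ} {g : TensorField} (hρ : 0 < ρ) (hg : IsSmoothMetric ρ g) {p : ℝ × ℝ}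
  (hp : p ∈ strip ρ)

include hg hp

lemma hasPD (i j k : Fin 2) :
    HasPD ρ i (fun q => g q j k) p (pderiv ρ i (fun q => g q j k) p) :=
  hasPD_of_contDiffOn (hg.smooth j k) i hp

lemma pderiv_christoffel_k10 (i k : Fin 2) :
    pderiv ρ i (christoffel ρ g k 1 0) p = pderiv ρ i (christoffel ρ g k 0 1) p :=
  pderiv_congr (fun _ hq => hg.christoffel_k10 hq k) hp

include hρ

lemma hasPD_pderiv (i l j k : Fin 2) :
    HasPD ρ i (pderiv ρ l (fun q => g q j k)) p (pderiv ρ i (pderiv ρ l (fun q => g q j k)) p) :=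
  hasPD_of_contDiffOn (contDiffOn_pderiv hρ (hg.smooth j k) l) i hp

/-- Brioschi's formula. -/
lemma scalarCurvature_eq : scalarCurvature ρ g p =
    ((g p 0 0 * g p 1 1 - g p 0 1 * g p 0 1) *
        (2 * pderiv ρ 0 (pderiv ρ 1 (fun q => g q 0 1)) p
          - pderiv ρ 1 (pderiv ρ 1 (fun q => g q 0 0)) p
          - pderiv ρ 0 (pderiv ρ 0 (fun q => g q 1 1)) p)
      - pderiv ρ 0 (fun q => g q 0 0) p * (g p 1 1 * (pderiv ρ 1 (fun q => g q 0 1) p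
          - 1 / 2 * pderiv ρ 0 (fun q => g q 1 1) p) - 1 / 2 * g p 0 1 *
          pderiv ρ 1 (fun q => g q 1 1) p)
      + 2 * (pderiv ρ 0 (fun q => g q 0 1) p - 1 / 2 * pderiv ρ 1 (fun q => g q 0 0) p) *
        (g p 0 1 * (pderiv ρ 1 (fun q => g q 0 1) p - 1 / 2 * pderiv ρ 0 (fun q => g q 1 1) p)
          - 1 / 2 * g p 0 0 * pderiv ρ 1 (fun q => g q 1 1) p)
      + 1 / 2 * g p 1 1 * pderiv ρ 1 (fun q => g q 0 0) p ^ 2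
      - g p 0 1 * pderiv ρ 1 (fun q => g q 0 0) p * pderiv ρ 0 (fun q => g q 1 1) p
      + 1 / 2 * g p 0 0 * pderiv ρ 0 (fun q => g q 1 1) p ^ 2) /
    (g p 0 0 * g p 1 1 - g p 0 1 * g p 0 1) ^ 2 := by
  have h000 (i : Fin 2) :=
    (hasPD_quotient hρ hp (hg.hasPD hp i 0 0) (hg.hasPD hp i 0 1) (hg.hasPD hp i 1 1)
      (hg.hasPD hp i 1 1) (hg.hasPD_pderiv hρ hp i 0 0 0) (hg.hasPD hp i 0 1)
      (((hg.hasPD_pderiv hρ hp i 0 0 1).const_mul hρ hp 2).sub hρ hp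
        (hg.hasPD_pderiv hρ hp i 1 0 0)) (hg.disc_pos hp)).congr hp
      (fun q hq => hg.christoffel000 hq)
  have h100 (i : Fin 2) :=
    (hasPD_quotient hρ hp (hg.hasPD hp i 0 0) (hg.hasPD hp i 0 1) (hg.hasPD hp i 1 1)
      (hg.hasPD hp i 0 0) (((hg.hasPD_pderiv hρ hp i 0 0 1).const_mul hρ hp 2).sub hρ hp
        (hg.hasPD_pderiv hρ hp i 1 0 0)) (hg.hasPD hp i 0 1) (hg.hasPD_pderiv hρ hp i 0 0 0)
      (hg.disc_pos hp)).congr hp (fun q hq => hg.christoffel100 hq)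
  have h001 (i : Fin 2) :=
    (hasPD_quotient hρ hp (hg.hasPD hp i 0 0) (hg.hasPD hp i 0 1) (hg.hasPD hp i 1 1)
      (hg.hasPD hp i 1 1) (hg.hasPD_pderiv hρ hp i 1 0 0) (hg.hasPD hp i 0 1)
      (hg.hasPD_pderiv hρ hp i 0 1 1) (hg.disc_pos hp)).congr hp
      (fun q hq => hg.christoffel001 hq)
  have h101 (i : Fin 2) :=
    (hasPD_quotient hρ hp (hg.hasPD hp i 0 0) (hg.hasPD hp i 0 1) (hg.hasPD hp i 1 1)
      (hg.hasPD hp i 0 0) (hg.hasPD_pderiv hρ hp i 0 1 1) (hg.hasPD hp i 0 1)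
      (hg.hasPD_pderiv hρ hp i 1 0 0) (hg.disc_pos hp)).congr hp
      (fun q hq => hg.christoffel101 hq)
  have h011 (i : Fin 2) :=
    (hasPD_quotient hρ hp (hg.hasPD hp i 0 0) (hg.hasPD hp i 0 1) (hg.hasPD hp i 1 1)
      (hg.hasPD hp i 1 1) (((hg.hasPD_pderiv hρ hp i 1 0 1).const_mul hρ hp 2).sub hρ hp
        (hg.hasPD_pderiv hρ hp i 0 1 1)) (hg.hasPD hp i 0 1) (hg.hasPD_pderiv hρ hp i 1 1 1)
      (hg.disc_pos hp)).congr hp (fun q hq => hg.christoffel011 hq)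
  have h111 (i : Fin 2) :=
    (hasPD_quotient hρ hp (hg.hasPD hp i 0 0) (hg.hasPD hp i 0 1) (hg.hasPD hp i 1 1)
      (hg.hasPD hp i 0 0) (hg.hasPD_pderiv hρ hp i 1 1 1) (hg.hasPD hp i 0 1)
      (((hg.hasPD_pderiv hρ hp i 1 0 1).const_mul hρ hp 2).sub hρ hp
        (hg.hasPD_pderiv hρ hp i 0 1 1)) (hg.disc_pos hp)).congr hp
      (fun q hq => hg.christoffel111 hq)
  have hD := (hg.disc_pos hp).ne'
  simp only [scalarCurvature, ricci, Fin.sum_univ_two, hg.inv00 hp, hg.inv01 hp, hg.inv10 hp,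
    hg.inv11 hp, pderiv_christoffel_k10 hg hp, hg.christoffel_k10 hp]
  simp only [fun i => (h000 i).2, fun i => (h100 i).2, fun i => (h001 i).2,
    fun i => (h101 i).2, fun i => (h011 i).2, fun i => (h111 i).2]
  rw [hg.christoffel000 hp, hg.christoffel100 hp, hg.christoffel001 hp, hg.christoffel101 hp,
    hg.christoffel011 hp, hg.christoffel111 hp]
  rw [pderiv_pderiv_comm hρ (hg.smooth 0 0) 1 0 hp, pderiv_pderiv_comm hρ (hg.smooth 0 1) 1 0 hp,
    pderiv_pderiv_comm hρ (hg.smooth 1 1) 1 0 hp]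
  generalize pderiv ρ 0 (pderiv ρ 0 (fun q => g q 0 0)) p = e00
  generalize pderiv ρ 0 (pderiv ρ 1 (fun q => g q 0 0)) p = e01
  generalize pderiv ρ 1 (pderiv ρ 1 (fun q => g q 0 0)) p = e11
  generalize pderiv ρ 0 (pderiv ρ 0 (fun q => g q 0 1)) p = f00
  generalize pderiv ρ 0 (pderiv ρ 1 (fun q => g q 0 1)) p = f01
  generalize pderiv ρ 1 (pderiv ρ 1 (fun q => g q 0 1)) p = f11
  generalize pderiv ρ 0 (pderiv ρ 0 (fun q => g q 1 1)) p = g00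
  generalize pderiv ρ 0 (pderiv ρ 1 (fun q => g q 1 1)) p = g01
  generalize pderiv ρ 1 (pderiv ρ 1 (fun q => g q 1 1)) p = g11
  generalize pderiv ρ 0 (fun q => g q 0 0) p = e0
  generalize pderiv ρ 1 (fun q => g q 0 0) p = e1
  generalize pderiv ρ 0 (fun q => g q 0 1) p = f0
  generalize pderiv ρ 1 (fun q => g q 0 1) p = f1
  generalize pderiv ρ 0 (fun q => g q 1 1) p = g0
  generalize pderiv ρ 1 (fun q => g q 1 1) p = g1
  -- With the determinant as an atom only powers of `D` are cleared; its value is restored for the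
  -- final polynomial identity.
  generalize hDD : g p 0 0 * g p 1 1 - g p 0 1 * g p 0 1 = D at *
  field_simp
  subst hDD
  ring

end IsSmoothMetric

/-! ### Curvature as a divergence. -/

/-- The vector field whose coordinate divergence is the scalar curvature density
`R √(det g)` (Liouville's formula). -/
def curvatureFlux (ρ : ℝ) (g : TensorField) (i : Fin 2) (p : ℝ × ℝ) : ℝ :=
  ![-1, 1] i * (2 * Real.sqrt (g p).det / g p 0 0 * christoffel ρ g 1 0 (![1, 0] i) p)

namespace IsSmoothMetric

variable {ρ : ℝ} {g : TensorField} (hρ : 0 < ρ) (hg : IsSmoothMetric ρ g) {p : ℝ × ℝ}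
  (hp : p ∈ strip ρ)

section
include hg hp

lemma curvatureFlux_zero_eq : curvatureFlux ρ g 0 p =
    (g p 0 1 * pderiv ρ 1 (fun q => g q 0 0) p - g p 0 0 * pderiv ρ 0 (fun q => g q 1 1) p) /
      (g p 0 0 * Real.sqrt (g p 0 0 * g p 1 1 - g p 0 1 * g p 0 1)) := by
  have hD := hg.disc_pos hp
  have hE := (hg.pos00 hp).ne'
  have hr := (Real.sqrt_pos.2 hD).ne'
  simp only [curvatureFlux, hg.det_eq hp, Matrix.cons_val_zero, hg.christoffel101 hp]
  rw [← Real.sq_sqrt hD.le]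
  simp only [Real.sqrt_sq (Real.sqrt_nonneg _)]
  field_simp
  ring

lemma curvatureFlux_one_eq : curvatureFlux ρ g 1 p =
    (g p 0 0 * (2 * pderiv ρ 0 (fun q => g q 0 1) p - pderiv ρ 1 (fun q => g q 0 0) p)
      - g p 0 1 * pderiv ρ 0 (fun q => g q 0 0) p) /
      (g p 0 0 * Real.sqrt (g p 0 0 * g p 1 1 - g p 0 1 * g p 0 1)) := by
  have hD := hg.disc_pos hp
  have hE := (hg.pos00 hp).ne'
  have hr := (Real.sqrt_pos.2 hD).ne'
  simp only [curvatureFlux, hg.det_eq hp, Matrix.cons_val_one, Matrix.cons_val_fin_one,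
    hg.christoffel100 hp]
  rw [← Real.sq_sqrt hD.le]
  simp only [Real.sqrt_sq (Real.sqrt_nonneg _)]
  field_simp

end

section
include hρ hg hp

/-- Liouville's formula for the curvature. -/
lemma scalarCurvature_mul_sqrt_det : scalarCurvature ρ g p * Real.sqrt (g p).det =
    pderiv ρ 0 (curvatureFlux ρ g 0) p + pderiv ρ 1 (curvatureFlux ρ g 1) p := by
  have hD := hg.disc_pos hp
  have hE := hg.pos00 hp
  have hr := Real.sqrt_pos.2 hD
  have hr2 := Real.sq_sqrt hD.le
  have hden (i : Fin 2) := (hg.hasPD hp i 0 0).mul hρ hp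
    ((((hg.hasPD hp i 0 0).mul hρ hp (hg.hasPD hp i 1 1)).sub hρ hp
      ((hg.hasPD hp i 0 1).mul hρ hp (hg.hasPD hp i 0 1))).sqrt hρ hp hD)
  have h0 := ((((hg.hasPD hp 0 0 1).mul hρ hp (hg.hasPD_pderiv hρ hp 0 1 0 0)).sub hρ hp
    ((hg.hasPD hp 0 0 0).mul hρ hp (hg.hasPD_pderiv hρ hp 0 0 1 1))).div hρ hp (hden 0)
    (mul_pos hE hr).ne').congr hp (fun q hq => hg.curvatureFlux_zero_eq hq)
  have h1 := ((((hg.hasPD hp 1 0 0).mul hρ hp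
      (((hg.hasPD_pderiv hρ hp 1 0 0 1).const_mul hρ hp 2).sub hρ hp
        (hg.hasPD_pderiv hρ hp 1 1 0 0))).sub hρ hp
    ((hg.hasPD hp 1 0 1).mul hρ hp (hg.hasPD_pderiv hρ hp 1 0 0 0))).div hρ hp (hden 1)
    (mul_pos hE hr).ne').congr hp (fun q hq => hg.curvatureFlux_one_eq hq)
  rw [h0.2, h1.2, hg.scalarCurvature_eq hρ hp, hg.det_eq hp]
  rw [pderiv_pderiv_comm hρ (hg.smooth 0 0) 1 0 hp, pderiv_pderiv_comm hρ (hg.smooth 0 1) 1 0 hp]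
  generalize pderiv ρ 0 (pderiv ρ 0 (fun q => g q 0 0)) p = e00
  generalize pderiv ρ 0 (pderiv ρ 1 (fun q => g q 0 0)) p = e01
  generalize pderiv ρ 1 (pderiv ρ 1 (fun q => g q 0 0)) p = e11
  generalize pderiv ρ 0 (pderiv ρ 0 (fun q => g q 0 1)) p = f00
  generalize pderiv ρ 0 (pderiv ρ 1 (fun q => g q 0 1)) p = f01
  generalize pderiv ρ 1 (pderiv ρ 1 (fun q => g q 0 1)) p = f11
  generalize pderiv ρ 0 (pderiv ρ 0 (fun q => g q 1 1)) p = g00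
  generalize pderiv ρ 0 (fun q => g q 0 0) p = e0
  generalize pderiv ρ 1 (fun q => g q 0 0) p = e1
  generalize pderiv ρ 0 (fun q => g q 0 1) p = f0
  generalize pderiv ρ 1 (fun q => g q 0 1) p = f1
  generalize pderiv ρ 0 (fun q => g q 1 1) p = g0
  generalize pderiv ρ 1 (fun q => g q 1 1) p = g1
  generalize Real.sqrt (g p 0 0 * g p 1 1 - g p 0 1 * g p 0 1) = r at *
  -- Eliminating `g₁₁` by `r² = det g` removes the only algebraic relation between the atoms, so
  -- that a rational identity remains.
  have hG : g p 1 1 = (r ^ 2 + g p 0 1 ^ 2) / g p 0 0 := by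
    field_simp; rw [hr2]; ring
  generalize g p 0 0 = E at *
  generalize g p 0 1 = F at *
  generalize g p 1 1 = G at *
  rw [← hr2]
  rw [hG]
  field_simp
  ring

end

section
include hg

lemma contDiffOn_sqrt_det : ContDiffOn ℝ ∞ (fun q => Real.sqrt (g q).det) (strip ρ) := by
  refine ContDiffOn.congr (f := fun q => Real.sqrt (g q 0 0 * g q 1 1 - g q 0 1 * g q 0 1)) ?_
    (fun q hq => by rw [hg.det_eq hq])
  exact ContDiffOn.sqrt (((hg.smooth 0 0).mul (hg.smooth 1 1)).sub
    ((hg.smooth 0 1).mul (hg.smooth 0 1))) (fun q hq => (hg.disc_pos hq).ne')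

include hρ

lemma contDiffOn_curvatureFlux (i : Fin 2) : ContDiffOn ℝ ∞ (curvatureFlux ρ g i) (strip ρ) := by
  have hs : ContDiffOn ℝ ∞ (fun q => g q 0 0 *
      Real.sqrt (g q 0 0 * g q 1 1 - g q 0 1 * g q 0 1)) (strip ρ) :=
    (hg.smooth 0 0).mul (ContDiffOn.sqrt (((hg.smooth 0 0).mul (hg.smooth 1 1)).sub
      ((hg.smooth 0 1).mul (hg.smooth 0 1))) (fun q hq => (hg.disc_pos hq).ne'))
  have hs0 : ∀ q ∈ strip ρ, g q 0 0 * Real.sqrt (g q 0 0 * g q 1 1 - g q 0 1 * g q 0 1) ≠ 0 :=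
    fun q hq => (mul_pos (hg.pos00 hq) (Real.sqrt_pos.2 (hg.disc_pos hq))).ne'
  have hd (l j k : Fin 2) := contDiffOn_pderiv hρ (hg.smooth j k) l
  fin_cases i
  · exact ((((hg.smooth 0 1).mul (hd 1 0 0)).sub ((hg.smooth 0 0).mul (hd 0 1 1))).div hs hs0).congr
      (fun q hq => hg.curvatureFlux_zero_eq hq)
  · exact ((((hg.smooth 0 0).mul ((contDiffOn_const (c := (2 : ℝ))).mul (hd 0 0 1) |>.sub (hd 1 0 0))).sub
      ((hg.smooth 0 1).mul (hd 0 0 0))).div hs hs0).congr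
      (fun q hq => hg.curvatureFlux_one_eq hq)

end

include hg in
-- The flux is built from the frame field `∂θ`, which exists on the whole cylinder. Hence it
-- descends there, and Gauss–Bonnet acquires no topological term.
lemma curvatureFlux_periodic (i : Fin 2) (θ s : ℝ) (hs : s ∈ Set.Icc (-ρ) ρ) :
    curvatureFlux ρ g i (θ + 2 * Real.pi, s) = curvatureFlux ρ g i (θ, s) := by
  have h1 : ∀ l j k : Fin 2, pderiv ρ l (fun q => g q j k) (θ + 2 * Real.pi, s) =
      pderiv ρ l (fun q => g q j k) (θ, s) := fun l j k =>
    pderiv_periodic (fun θ s hs => by rw [hg.periodic θ s hs]) θ s hs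
  simp only [curvatureFlux, christoffel, h1, hg.periodic θ s hs]

include hg in
/-- The geodesic curvature of the boundary in terms of the flux. -/
lemma geodesicCurvature_mul (hρ : 0 < ρ) (hp : p ∈ stripBoundary ρ) :
    geodesicCurvature ρ g p * Real.sqrt (g p 0 0) =
      -(Real.sign p.2 * curvatureFlux ρ g 1 p) / 2 := by
  have hp' : p ∈ strip ρ := by
    rw [mem_strip]; rcases hp with h | h <;> rw [h] <;> constructor <;> linarith
  have hD := hg.disc_pos hp'
  have hE := hg.pos00 hp'
  have hr := Real.sqrt_pos.2 hD
  have hr2 := Real.sq_sqrt hD.le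
  have hx := Real.sqrt_pos.2 hE
  have hx2 := Real.sq_sqrt hE.le
  simp only [geodesicCurvature, outwardNormal, curvatureFlux, Fin.sum_univ_two, hg.inv01 hp',
    hg.inv11 hp', hg.symm hp', hg.det_eq hp', Matrix.cons_val_one, Matrix.cons_val_fin_one]
  rw [Real.sqrt_div hE.le]
  generalize Real.sqrt (g p 0 0 * g p 1 1 - g p 0 1 * g p 0 1) = r at *
  have hG : g p 1 1 = (r ^ 2 + g p 0 1 ^ 2) / g p 0 0 := by
    field_simp; rw [hr2]; ring
  rw [← hr2, hG]
  generalize Real.sqrt (g p 0 0) = x at *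
  rw [← hx2]
  field_simp
  ring

end IsSmoothMetric

/-! ### Conformal change of metric. -/

/-- The gradient of `w` multiplied by the area density: `√(det g) gⁱʲ ∂ⱼ w`. -/
def gradFlux (ρ : ℝ) (g : TensorField) (w : ℝ × ℝ → ℝ) (i : Fin 2) (p : ℝ × ℝ) : ℝ :=
  Real.sqrt (g p).det * ∑ j, (g p)⁻¹ i j * pderiv ρ j w p

/-- `h = eʷ g` on the cylinder. -/
structure IsConformal (ρ : ℝ) (w : ℝ × ℝ → ℝ) (g h : TensorField) : Prop where
  smooth : ContDiffOn ℝ ∞ w (strip ρ)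
  left : IsSmoothMetric ρ g
  right : IsSmoothMetric ρ h
  eq : ∀ p ∈ strip ρ, h p = Real.exp (w p) • g p

namespace IsSmoothMetric

variable {ρ : ℝ} {g : TensorField} (hg : IsSmoothMetric ρ g) {p : ℝ × ℝ}
  {w : ℝ × ℝ → ℝ}

section
include hg

lemma gradFlux_zero_eq (hp : p ∈ strip ρ) : gradFlux ρ g w 0 p =
    (g p 1 1 * pderiv ρ 0 w p - g p 0 1 * pderiv ρ 1 w p) / Real.sqrt (g p).det := by
  have hD := hg.disc_pos hp
  have hr := (Real.sqrt_pos.2 hD).ne'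
  have hr2 := Real.sq_sqrt hD.le
  simp only [gradFlux, Fin.sum_univ_two, hg.inv00 hp, hg.inv01 hp, hg.det_eq hp]
  generalize Real.sqrt (g p 0 0 * g p 1 1 - g p 0 1 * g p 0 1) = r at *
  rw [← hr2]
  field_simp
  ring

lemma gradFlux_one_eq (hp : p ∈ strip ρ) : gradFlux ρ g w 1 p =
    (g p 0 0 * pderiv ρ 1 w p - g p 0 1 * pderiv ρ 0 w p) / Real.sqrt (g p).det := by
  have hD := hg.disc_pos hp
  have hr := (Real.sqrt_pos.2 hD).ne'
  have hr2 := Real.sq_sqrt hD.le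
  simp only [gradFlux, Fin.sum_univ_two, hg.inv10 hp, hg.inv11 hp, hg.det_eq hp]
  generalize Real.sqrt (g p 0 0 * g p 1 1 - g p 0 1 * g p 0 1) = r at *
  rw [← hr2]
  field_simp
  ring

lemma sqrt_det_pos (hp : p ∈ strip ρ) : 0 < Real.sqrt (g p).det :=
  Real.sqrt_pos.2 (hg.posDef p hp).det_pos

lemma contDiffOn_gradFlux (hρ : 0 < ρ) (hw : ContDiffOn ℝ ∞ w (strip ρ)) (i : Fin 2) :
    ContDiffOn ℝ ∞ (gradFlux ρ g w i) (strip ρ) := by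
  have hd (l : Fin 2) := contDiffOn_pderiv hρ hw l
  have hr : ∀ q ∈ strip ρ, Real.sqrt (g q).det ≠ 0 := fun q hq => (hg.sqrt_det_pos hq).ne'
  fin_cases i
  · exact ((((hg.smooth 1 1).mul (hd 0)).sub ((hg.smooth 0 1).mul (hd 1))).div
      hg.contDiffOn_sqrt_det hr).congr fun q hq => hg.gradFlux_zero_eq hq
  · exact ((((hg.smooth 0 0).mul (hd 1)).sub ((hg.smooth 0 1).mul (hd 0))).div
      hg.contDiffOn_sqrt_det hr).congr fun q hq => hg.gradFlux_one_eq hq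

lemma gradFlux_periodic
    (hw : ∀ θ s, s ∈ Set.Icc (-ρ) ρ → w (θ + 2 * Real.pi, s) = w (θ, s)) (i : Fin 2) (θ s : ℝ)
    (hs : s ∈ Set.Icc (-ρ) ρ) :
    gradFlux ρ g w i (θ + 2 * Real.pi, s) = gradFlux ρ g w i (θ, s) := by
  simp only [gradFlux, hg.periodic θ s hs, pderiv_periodic hw θ s hs]

/-- The divergence of the gradient at a critical point. -/
lemma divergence_gradFlux_of_critical (hρ : 0 < ρ) (hw : ContDiffOn ℝ ∞ w (strip ρ))
    (hp : p ∈ strip ρ) (h0 : pderiv ρ 0 w p = 0) (h1 : pderiv ρ 1 w p = 0) :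
    pderiv ρ 0 (gradFlux ρ g w 0) p + pderiv ρ 1 (gradFlux ρ g w 1) p =
      (g p 1 1 * pderiv ρ 0 (pderiv ρ 0 w) p - 2 * g p 0 1 * pderiv ρ 0 (pderiv ρ 1 w) p +
        g p 0 0 * pderiv ρ 1 (pderiv ρ 1 w) p) / Real.sqrt (g p).det := by
  have hd (i l : Fin 2) := hasPD_of_contDiffOn (contDiffOn_pderiv hρ hw l) i hp
  have hr := (hg.sqrt_det_pos hp).ne'
  have hrd (i : Fin 2) := hasPD_of_contDiffOn hg.contDiffOn_sqrt_det i hp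
  have e0 := ((((hg.hasPD hp 0 1 1).mul hρ hp (hd 0 0)).sub hρ hp
    ((hg.hasPD hp 0 0 1).mul hρ hp (hd 0 1))).div hρ hp (hrd 0) hr).congr hp
    fun q hq => hg.gradFlux_zero_eq hq
  have e1 := ((((hg.hasPD hp 1 0 0).mul hρ hp (hd 1 1)).sub hρ hp
    ((hg.hasPD hp 1 0 1).mul hρ hp (hd 1 0))).div hρ hp (hrd 1) hr).congr hp
    fun q hq => hg.gradFlux_one_eq hq
  rw [e0.2, e1.2, pderiv_pderiv_comm hρ hw 1 0 hp, h0, h1]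
  field_simp
  ring

end

end IsSmoothMetric

namespace IsConformal

variable {ρ : ℝ} {g h : TensorField} {p : ℝ × ℝ} {w : ℝ × ℝ → ℝ} (H : IsConformal ρ w g h)

include H

lemma apply (hp : p ∈ strip ρ) (i j : Fin 2) : h p i j = Real.exp (w p) * g p i j := by
  rw [H.eq p hp]; rfl

lemma sqrt_det (hp : p ∈ strip ρ) :
    Real.sqrt (h p).det = Real.exp (w p) * Real.sqrt (g p).det := by
  rw [H.eq p hp, Matrix.det_smul, Fintype.card_fin, Real.sqrt_mul (by positivity),
    Real.sqrt_sq (Real.exp_pos _).le]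

lemma pderiv_apply (hρ : 0 < ρ) (hp : p ∈ strip ρ) (l i j : Fin 2) :
    pderiv ρ l (fun q => h q i j) p =
      Real.exp (w p) * (pderiv ρ l w p * g p i j + pderiv ρ l (fun q => g q i j) p) := by
  rw [((((hasPD_of_contDiffOn H.smooth l hp).exp hρ hp).mul hρ hp (H.left.hasPD hp l i j)).congr hp
    fun q hq => H.apply hq i j).2]
  ring

/-- The powers of `eʷ` cancel between numerator and denominator, and only the derivatives falling on
`eʷ` survive. Both transformation laws follow from this: the divergence gives the one for `R`, the
component normal to the boundary the one for `k`. -/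
lemma curvatureFlux_eq (hρ : 0 < ρ) (hp : p ∈ strip ρ) (i : Fin 2) :
    curvatureFlux ρ h i p = curvatureFlux ρ g i p - gradFlux ρ g w i p := by
  have hD := H.left.disc_pos hp
  have hE := H.left.pos00 hp
  have hr := Real.sqrt_pos.2 hD
  have hr2 := Real.sq_sqrt hD.le
  have hs := H.sqrt_det hp
  rw [H.left.det_eq hp, H.right.det_eq hp] at hs
  have he := Real.exp_pos (w p)
  have hG : g p 1 1 = ((Real.sqrt (g p 0 0 * g p 1 1 - g p 0 1 * g p 0 1)) ^ 2 + g p 0 1 ^ 2) /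
      g p 0 0 := by
    rw [hr2]; field_simp; ring
  fin_cases i
  · change curvatureFlux ρ h 0 p = curvatureFlux ρ g 0 p - gradFlux ρ g w 0 p
    rw [H.left.curvatureFlux_zero_eq hp, H.right.curvatureFlux_zero_eq hp,
      H.left.gradFlux_zero_eq hp, hs, H.left.det_eq hp]
    simp only [H.apply hp, H.pderiv_apply hρ hp]
    generalize Real.sqrt (g p 0 0 * g p 1 1 - g p 0 1 * g p 0 1) = r at *
    rw [hG]
    field_simp
    ring
  · change curvatureFlux ρ h 1 p = curvatureFlux ρ g 1 p - gradFlux ρ g w 1 p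
    rw [H.left.curvatureFlux_one_eq hp, H.right.curvatureFlux_one_eq hp,
      H.left.gradFlux_one_eq hp, hs, H.left.det_eq hp]
    simp only [H.apply hp, H.pderiv_apply hρ hp]
    generalize Real.sqrt (g p 0 0 * g p 1 1 - g p 0 1 * g p 0 1) = r at *
    field_simp
    ring

/-- The conformal change of the scalar curvature density. -/
lemma scalarCurvature_mul_sqrt_det (hρ : 0 < ρ) (hp : p ∈ strip ρ) :
    scalarCurvature ρ h p * Real.sqrt (h p).det = scalarCurvature ρ g p * Real.sqrt (g p).det -
      (pderiv ρ 0 (gradFlux ρ g w 0) p + pderiv ρ 1 (gradFlux ρ g w 1) p) := by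
  rw [H.right.scalarCurvature_mul_sqrt_det hρ hp, H.left.scalarCurvature_mul_sqrt_det hρ hp]
  have key (i : Fin 2) := ((hasPD_of_contDiffOn (H.left.contDiffOn_curvatureFlux hρ i) i hp).sub
    hρ hp (hasPD_of_contDiffOn (H.left.contDiffOn_gradFlux hρ H.smooth i) i hp)).congr hp
    fun q hq => H.curvatureFlux_eq hρ hq i
  rw [(key 0).2, (key 1).2]
  ring

/-- The conformal change of the geodesic curvature of the boundary. -/
lemma sign_mul_gradFlux (hρ : 0 < ρ) (hp : p ∈ stripBoundary ρ) :
    Real.sign p.2 * gradFlux ρ g w 1 p =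
      2 * Real.sqrt (g p 0 0) * (geodesicCurvature ρ h p * Real.exp (w p / 2) -
        geodesicCurvature ρ g p) := by
  have hp' : p ∈ strip ρ := by
    rw [mem_strip]; rcases hp with h | h <;> rw [h] <;> constructor <;> linarith
  have h1 := H.left.geodesicCurvature_mul hρ hp
  have h2 := H.right.geodesicCurvature_mul hρ hp
  rw [H.curvatureFlux_eq hρ hp', H.apply hp', Real.sqrt_mul (Real.exp_pos _).le,
    ← Real.exp_half] at h2
  linear_combination 2 * h1 - 2 * h2

end IsConformal

/-! ### Maximum points and the maximum principle. -/

/-- If `H > 0`, then `ψ = φ'` would be positive just to the right of `0` and `φ` would rise above `φ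
0`. Only one side is used, so the test applies along inward segments at the boundary. -/
lemma second_deriv_nonpos_of_max {φ ψ : ℝ → ℝ} {δ H : ℝ} (hδ : 0 < δ)
    (hφ : ∀ r ∈ Set.Icc 0 δ, HasDerivWithinAt φ (ψ r) (Set.Icc 0 δ) r)
    (hψ : HasDerivWithinAt ψ H (Set.Icc 0 δ) 0) (h0 : ψ 0 = 0)
    (hmax : ∀ r ∈ Set.Icc 0 δ, φ r ≤ φ 0) : H ≤ 0 := by
  by_contra! hH
  have hev := (hasDerivWithinAt_iff_tendsto_slope.1 hψ).eventually (lt_mem_nhds hH)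
  rw [eventually_nhdsWithin_iff, Metric.eventually_nhds_iff] at hev
  obtain ⟨ε, hε, hev⟩ := hev
  have hpos : ∀ r ∈ Set.Ioo 0 (min δ ε), 0 < ψ r := by
    intro r hr
    have hr1 := lt_min_iff.1 hr.2
    have := hev (y := r) (by simpa [abs_of_pos hr.1] using hr1.2)
      ⟨⟨hr.1.le, hr1.1.le⟩, hr.1.ne'⟩
    rw [slope_def_field, h0, sub_zero, sub_zero] at this
    exact (div_pos_iff_of_pos_right hr.1).1 this
  set η := min δ ε / 2 with hη
  have hmin : 0 < min δ ε := lt_min hδ hε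
  have hηδ : η < δ := by have := min_le_left δ ε; linarith
  have hmono : StrictMonoOn φ (Set.Icc 0 η) := by
    refine strictMonoOn_of_deriv_pos (convex_Icc _ _) (fun r hr => ?_) (fun r hr => ?_)
    · exact ((hφ r ⟨hr.1, hr.2.trans hηδ.le⟩).continuousWithinAt).mono
        (Set.Icc_subset_Icc_right hηδ.le)
    · rw [interior_Icc] at hr
      have hr' : r < δ := hr.2.trans hηδ
      rw [((hφ r ⟨hr.1.le, hr'.le⟩).hasDerivAt (Icc_mem_nhds hr.1 hr')).deriv]
      exact hpos r ⟨hr.1, by linarith [hr.2]⟩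
  have := hmono (Set.left_mem_Icc.2 (by positivity)) (Set.right_mem_Icc.2 (by positivity))
    (by positivity)
  exact absurd (hmax η ⟨by positivity, hηδ.le⟩) (by linarith)

section Maximum

variable {ρ : ℝ} {w : ℝ × ℝ → ℝ} {p v : ℝ × ℝ}

lemma segment_mem_strip (hp : p ∈ strip ρ) (hv : p + v ∈ strip ρ) {r : ℝ}
    (hr : r ∈ Set.Icc (0 : ℝ) 1) : p + r • v ∈ strip ρ :=
  (convex_strip ρ).add_smul_mem hp hv hr

lemma hasDerivWithinAt_segment {f : ℝ × ℝ → ℝ} (hf : ContDiffOn ℝ ∞ f (strip ρ))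
    (hp : p ∈ strip ρ) (hv : p + v ∈ strip ρ) {r : ℝ} (hr : r ∈ Set.Icc (0 : ℝ) 1) :
    HasDerivWithinAt (fun r : ℝ => f (p + r • v))
      (v.1 * pderiv ρ 0 f (p + r • v) + v.2 * pderiv ρ 1 f (p + r • v)) (Set.Icc 0 1) r := by
  rw [← fderivWithin_apply_eq]
  have h1 : HasDerivWithinAt (fun r : ℝ => p + r • v) v (Set.Icc 0 1) r := by
    simpa using ((hasDerivWithinAt_id r (Set.Icc (0 : ℝ) 1)).smul_const v).const_add p
  exact ((hf.differentiableOn (by simp) _ (segment_mem_strip hp hv hr)).hasFDerivWithinAt).comp_hasDerivWithinAt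
    r h1 (fun x hx => segment_mem_strip hp hv hx)

lemma first_order_of_max (hw : ContDiffOn ℝ ∞ w (strip ρ)) (hp : p ∈ strip ρ)
    (hmax : ∀ q ∈ strip ρ, w q ≤ w p) (hv : p + v ∈ strip ρ) :
    v.1 * pderiv ρ 0 w p + v.2 * pderiv ρ 1 w p ≤ 0 := by
  have h0 : (0 : ℝ) ∈ Set.Icc (0 : ℝ) 1 := by simp
  have hd := hasDerivWithinAt_segment hw hp hv h0
  have ht := hasDerivWithinAt_iff_tendsto_slope.1 hd
  have hne : (nhdsWithin (0 : ℝ) (Set.Icc 0 1 \ {0})).NeBot := by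
    have : Set.Ioo (0 : ℝ) 1 ⊆ Set.Icc 0 1 \ {0} := fun x hx => ⟨⟨hx.1.le, hx.2.le⟩, hx.1.ne'⟩
    have h2 : (nhdsWithin (0 : ℝ) (Set.Ioo 0 1)).NeBot := by
      rw [nhdsWithin_Ioo_eq_nhdsGT one_pos]; infer_instance
    exact h2.mono (nhdsWithin_mono _ this)
  simp only [zero_smul, add_zero] at ht
  refine le_of_tendsto ht ?_
  filter_upwards [self_mem_nhdsWithin] with r hr
  rw [slope_def_field]
  have := hmax _ (segment_mem_strip hp hv hr.1)
  simp only [zero_smul, add_zero, sub_zero]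
  exact div_nonpos_of_nonpos_of_nonneg (by linarith) hr.1.1

lemma second_order_of_max (hρ : 0 < ρ) (hw : ContDiffOn ℝ ∞ w (strip ρ)) (hp : p ∈ strip ρ)
    (hmax : ∀ q ∈ strip ρ, w q ≤ w p) (h0 : pderiv ρ 0 w p = 0) (h1 : pderiv ρ 1 w p = 0)
    (hv : p + v ∈ strip ρ) :
    v.1 ^ 2 * pderiv ρ 0 (pderiv ρ 0 w) p + 2 * v.1 * v.2 * pderiv ρ 0 (pderiv ρ 1 w) p +
      v.2 ^ 2 * pderiv ρ 1 (pderiv ρ 1 w) p ≤ 0 := by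
  have h0' : (0 : ℝ) ∈ Set.Icc (0 : ℝ) 1 := by simp
  have hd (i : Fin 2) := hasDerivWithinAt_segment (contDiffOn_pderiv hρ hw i) hp hv h0'
  refine second_deriv_nonpos_of_max (δ := 1) one_pos
    (fun r hr => hasDerivWithinAt_segment hw hp hv hr) ?_ (by simp [h0, h1])
    (fun r hr => by simpa using hmax _ (segment_mem_strip hp hv hr))
  have := ((hd 0).const_mul v.1).add ((hd 1).const_mul v.2)
  refine this.congr_deriv ?_
  simp only [zero_smul, add_zero]
  rw [pderiv_pderiv_comm hρ hw 1 0 hp]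
  ring

/-- At a maximum with vanishing gradient, the Hessian is negative semidefinite, also at a boundary
point. -/
lemma hessian_nonpos_of_max (hρ : 0 < ρ) (hw : ContDiffOn ℝ ∞ w (strip ρ)) (hp : p ∈ strip ρ)
    (hmax : ∀ q ∈ strip ρ, w q ≤ w p) (h0 : pderiv ρ 0 w p = 0) (h1 : pderiv ρ 1 w p = 0)
    (a b : ℝ) :
    a ^ 2 * pderiv ρ 0 (pderiv ρ 0 w) p + 2 * a * b * pderiv ρ 0 (pderiv ρ 1 w) p +
      b ^ 2 * pderiv ρ 1 (pderiv ρ 1 w) p ≤ 0 := by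
  -- The quadratic form is even, so the direction may be reversed to point into the strip; dividing
  -- by `|b| + 1` keeps the endpoint inside and allows `b = 0`.
  obtain ⟨c, hc, hcb⟩ : ∃ c : ℝ, c ≠ 0 ∧ p + (c * a, c * b) ∈ strip ρ := by
    rw [mem_strip] at hp
    have hb : 0 < |b| + 1 := by positivity
    have hbb := neg_abs_le b
    have hbb' := le_abs_self b
    rcases lt_or_ge p.2 ρ with h | h
    · have hc : 0 < (ρ - p.2) / (|b| + 1) := div_pos (by linarith) hb
      have hcc : (ρ - p.2) / (|b| + 1) * (|b| + 1) = ρ - p.2 := by field_simp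
      rcases le_total 0 b with h' | h'
      · refine ⟨(ρ - p.2) / (|b| + 1), hc.ne', ?_⟩
        rw [mem_strip]; simp only [Prod.snd_add]; constructor <;> nlinarith
      · refine ⟨-((ρ - p.2) / (|b| + 1)), (neg_neg_of_pos hc).ne, ?_⟩
        rw [mem_strip]; simp only [Prod.snd_add]; constructor <;> nlinarith
    · have hc : 0 < 2 * ρ / (|b| + 1) := by positivity
      have hcc : 2 * ρ / (|b| + 1) * (|b| + 1) = 2 * ρ := by field_simp
      have hpe : p.2 = ρ := le_antisymm hp.2 h
      rcases le_total 0 b with h' | h'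
      · refine ⟨-(2 * ρ / (|b| + 1)), (neg_neg_of_pos hc).ne, ?_⟩
        rw [mem_strip]; simp only [Prod.snd_add]; constructor <;> nlinarith
      · refine ⟨2 * ρ / (|b| + 1), hc.ne', ?_⟩
        rw [mem_strip]; simp only [Prod.snd_add]; constructor <;> nlinarith
  have := second_order_of_max hρ hw hp hmax h0 h1 hcb
  have hc2 : 0 < c ^ 2 := by positivity
  by_contra! hcon
  have := mul_pos hc2 hcon
  simp only at *
  nlinarith

end Maximum

/-- Comparison of scalar curvatures of conformal metrics at a positive maximum of the logarithm
of the conformal factor. -/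
lemma IsConformal.scalarCurvature_le_of_max {ρ : ℝ} {g h : TensorField} {p : ℝ × ℝ}
    {w : ℝ × ℝ → ℝ} (H : IsConformal ρ w g h) (hρ : 0 < ρ)
    (hk : ∀ q ∈ stripBoundary ρ, geodesicCurvature ρ h q = geodesicCurvature ρ g q)
    (hk0 : ∀ q ∈ stripBoundary ρ, geodesicCurvature ρ g q ≤ 0)
    (hp : p ∈ strip ρ) (hmax : ∀ q ∈ strip ρ, w q ≤ w p) (hpos : 0 < w p) :
    scalarCurvature ρ g p ≤ Real.exp (w p) * scalarCurvature ρ h p := by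
  have hE := H.left.pos00 hp
  have hr := H.left.sqrt_det_pos hp
  have hps := mem_strip.1 hp
  have h0 : pderiv ρ 0 w p = 0 := by
    have e1 := first_order_of_max (v := (1, 0)) H.smooth hp hmax (by simpa [mem_strip] using hps)
    have e2 := first_order_of_max (v := (-1, 0)) H.smooth hp hmax (by simpa [mem_strip] using hps)
    simp only at e1 e2
    linarith
  -- Equality of the geodesic curvatures makes the outward flux `2 √g₀₀ k (e^(w/2) - 1)`, which is
  -- nonpositive because `k ≤ 0` and `w p > 0`.
  have hbd : p ∈ stripBoundary ρ → Real.sign p.2 * pderiv ρ 1 w p ≤ 0 := by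
    intro hb
    have e := H.sign_mul_gradFlux hρ hb
    rw [hk p hb, H.left.gradFlux_one_eq hp, h0] at e
    have hex : 1 < Real.exp (w p / 2) := Real.one_lt_exp_iff.2 (by linarith)
    have : 2 * Real.sqrt (g p 0 0) * (geodesicCurvature ρ g p * Real.exp (w p / 2) -
        geodesicCurvature ρ g p) ≤ 0 :=
      mul_nonpos_of_nonneg_of_nonpos (by positivity) (by nlinarith [hk0 p hb])
    rw [← e] at this
    by_contra! hcon
    have h2 : 0 < Real.sign p.2 * pderiv ρ 1 w p * (g p 0 0 / Real.sqrt (g p).det) := by positivity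
    refine absurd this (not_le.2 (h2.trans_eq ?_))
    ring
  -- At a boundary point, maximality along the inward segment supplies the sign opposite to `hbd`.
  have h1 : pderiv ρ 1 w p = 0 := by
    refine le_antisymm ?_ ?_
    · rcases lt_or_ge p.2 ρ with h | h
      · have e1 := first_order_of_max (v := (0, ρ - p.2)) H.smooth hp hmax
          (by rw [mem_strip]; simp only [Prod.snd_add]; constructor <;> linarith)
        simp only at e1
        by_contra! hcon
        nlinarith [mul_pos (sub_pos.2 h) hcon]
      · have hpe : p.2 = ρ := le_antisymm hps.2 h
        have := hbd (Or.inr hpe)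
        rwa [hpe, Real.sign_of_pos hρ, one_mul] at this
    · rcases lt_or_ge (-ρ) p.2 with h | h
      · have e1 := first_order_of_max (v := (0, -ρ - p.2)) H.smooth hp hmax
          (by rw [mem_strip]; simp only [Prod.snd_add]; constructor <;> linarith)
        simp only at e1
        by_contra! hcon
        nlinarith [mul_pos (sub_pos.2 h) (neg_pos.2 hcon)]
      · have hpe : p.2 = -ρ := le_antisymm h hps.1
        have := hbd (Or.inl hpe)
        rw [hpe, Real.sign_of_neg (by linarith)] at this
        linarith
  have hdiv : pderiv ρ 0 (gradFlux ρ g w 0) p + pderiv ρ 1 (gradFlux ρ g w 1) p ≤ 0 := by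
    rw [H.left.divergence_gradFlux_of_critical hρ H.smooth hp h0 h1]
    refine div_nonpos_of_nonpos_of_nonneg ?_ hr.le
    have hD := H.left.disc_pos hp
    have q1 := hessian_nonpos_of_max hρ H.smooth hp hmax h0 h1 1 0
    -- Completing the square: `g₀₀` times the numerator is `det g` times the form on `(1, 0)` plus
    -- the form on `(-g₀₁, g₀₀)`.
    have q2 := hessian_nonpos_of_max hρ H.smooth hp hmax h0 h1 (-g p 0 1) (g p 0 0)
    by_contra! hcon
    nlinarith [mul_pos hE hcon]
  have key := H.scalarCurvature_mul_sqrt_det hρ hp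
  rw [H.sqrt_det hp] at key
  have : scalarCurvature ρ g p * Real.sqrt (g p).det ≤
      Real.exp (w p) * scalarCurvature ρ h p * Real.sqrt (g p).det := by linarith
  exact le_of_mul_le_mul_right this hr

lemma deriv_nonneg_of_max_right {f : ℝ → ℝ} {f' t : ℝ} (ht : 0 < t) (hf : HasDerivAt f f' t)
    (hmax : ∀ s ∈ Set.Icc 0 t, f s ≤ f t) : 0 ≤ f' := by
  have h1 := (hasDerivWithinAt_iff_tendsto_slope' (Set.self_notMem_Iio)).1
    (hf.hasDerivWithinAt (s := Set.Iio t))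
  refine ge_of_tendsto h1 ?_
  have : Set.Ioi (0 : ℝ) ∈ nhdsWithin t (Set.Iio t) := mem_nhdsWithin_of_mem_nhds (Ioi_mem_nhds ht)
  filter_upwards [self_mem_nhdsWithin, this] with s hs hs0
  have hs' : s < t := hs
  rw [slope_def_field]
  exact div_nonneg_of_nonpos (by linarith [hmax s ⟨le_of_lt hs0, hs'.le⟩]) (by linarith)

lemma exists_mem_Icc_of_periodic {ρ : ℝ} {f : ℝ × ℝ → ℝ}
    (hf : ∀ θ s, s ∈ Set.Icc (-ρ) ρ → f (θ + 2 * Real.pi, s) = f (θ, s)) {p : ℝ × ℝ}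
    (hp : p ∈ strip ρ) :
    ∃ q ∈ Set.Icc 0 (2 * Real.pi) ×ˢ Set.Icc (-ρ) ρ, f p = f q := by
  have hper : Function.Periodic (fun θ => f (θ, p.2)) (2 * Real.pi) := fun θ => hf θ p.2 hp.2
  obtain ⟨y, hy, hfy⟩ := hper.exists_mem_Ico₀ Real.two_pi_pos p.1
  exact ⟨(y, p.2), ⟨Set.Ico_subset_Icc_self hy, hp.2⟩, hfy⟩

lemma rectangle_subset_strip (ρ : ℝ) :
    Set.Icc 0 (2 * Real.pi) ×ˢ Set.Icc (-ρ) ρ ⊆ strip ρ := fun _ hq => ⟨trivial, hq.2⟩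

/-- A maximum principle on the cylinder. -/
lemma maximum_principle {ρ τ C : ℝ} {w w' : ℝ → ℝ × ℝ → ℝ}
    (hcont : ContinuousOn (fun q : ℝ × (ℝ × ℝ) => w q.1 q.2) (Set.Icc 0 τ ×ˢ strip ρ))
    (hper : ∀ t ∈ Set.Icc 0 τ, ∀ θ s, s ∈ Set.Icc (-ρ) ρ →
      w t (θ + 2 * Real.pi, s) = w t (θ, s))
    (hinit : ∀ p ∈ strip ρ, w 0 p ≤ 0)
    (hder : ∀ t ∈ Set.Ioc 0 τ, ∀ p ∈ strip ρ, HasDerivAt (fun r => w r p) (w' t p) t)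
    (hmax : ∀ t ∈ Set.Ioc 0 τ, ∀ p ∈ strip ρ, (∀ q ∈ strip ρ, w t q ≤ w t p) → 0 < w t p →
      w' t p ≤ C * w t p) :
    ∀ t ∈ Set.Icc 0 τ, ∀ p ∈ strip ρ, w t p ≤ 0 := by
  intro t ht p hp
  by_contra! hpos
  obtain ⟨p₀, hp₀, hpp⟩ := exists_mem_Icc_of_periodic (hper t ht) hp
  rw [hpp] at hpos
  set K : Set (ℝ × (ℝ × ℝ)) := Set.Icc 0 τ ×ˢ (Set.Icc 0 (2 * Real.pi) ×ˢ Set.Icc (-ρ) ρ) with hK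
  have hKc : IsCompact K := isCompact_Icc.prod (isCompact_Icc.prod isCompact_Icc)
  have hKs : K ⊆ Set.Icc 0 τ ×ˢ strip ρ :=
    Set.prod_mono subset_rfl (rectangle_subset_strip ρ)
  -- The exponent exceeds `C` by one, so that at a positive space-time maximum the weighted function
  -- has strictly negative time derivative.
  have hvc : ContinuousOn (fun q : ℝ × (ℝ × ℝ) => Real.exp (-(C + 1) * q.1) * w q.1 q.2) K :=
    (by fun_prop : Continuous fun q : ℝ × (ℝ × ℝ) => Real.exp (-(C + 1) * q.1)).continuousOn.mul
      (hcont.mono hKs)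
  obtain ⟨⟨t₁, p₁⟩, hq₁, hM⟩ := hKc.exists_isMaxOn ⟨(t, p₀), ht, hp₀⟩ hvc
  have hM' : ∀ s ∈ Set.Icc 0 τ, ∀ q ∈ strip ρ,
      Real.exp (-(C + 1) * s) * w s q ≤ Real.exp (-(C + 1) * t₁) * w t₁ p₁ := by
    intro s hs q hq
    obtain ⟨q₀, hq₀, hqq⟩ := exists_mem_Icc_of_periodic (hper s hs) hq
    rw [hqq]
    exact hM (a := (s, q₀)) ⟨hs, hq₀⟩
  have ht₁ : t₁ ∈ Set.Icc 0 τ := hq₁.1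
  have hp₁ : p₁ ∈ strip ρ := rectangle_subset_strip ρ hq₁.2
  have hw₁ : 0 < w t₁ p₁ := by
    have := (mul_pos (Real.exp_pos (-(C + 1) * t)) hpos).trans_le
      (hM' t ht p₀ (rectangle_subset_strip ρ hp₀))
    exact (mul_pos_iff_of_pos_left (Real.exp_pos _)).1 this
  have ht₁0 : 0 < t₁ := by
    refine lt_of_le_of_ne ht₁.1 ?_
    rintro rfl
    exact absurd (hinit p₁ hp₁) (not_le.2 hw₁)
  have hd := hmax t₁ ⟨ht₁0, ht₁.2⟩ p₁ hp₁ (fun q hq => by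
    have := hM' t₁ ht₁ q hq
    exact le_of_mul_le_mul_left this (Real.exp_pos _)) hw₁
  have he : HasDerivAt (fun s => Real.exp (-(C + 1) * s)) (Real.exp (-(C + 1) * t₁) * -(C + 1)) t₁ := by
    simpa using ((hasDerivAt_id t₁).const_mul (-(C + 1))).exp
  have := deriv_nonneg_of_max_right ht₁0 (he.mul (hder t₁ ⟨ht₁0, ht₁.2⟩ p₁ hp₁))
    (fun s hs => hM' s ⟨hs.1, hs.2.trans ht₁.2⟩ p₁ hp₁)
  have h2 : Real.exp (-(C + 1) * t₁) * (w' t₁ p₁ - (C + 1) * w t₁ p₁) < 0 :=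
    mul_neg_of_pos_of_neg (Real.exp_pos _) (by linarith)
  linarith

section Congr

variable {ρ : ℝ} {g h : TensorField} (hgh : ∀ q ∈ strip ρ, g q = h q) {p : ℝ × ℝ}

include hgh

lemma christoffel_congr (hp : p ∈ strip ρ) (k i j : Fin 2) :
    christoffel ρ g k i j p = christoffel ρ h k i j p := by
  have hd (l a b : Fin 2) : pderiv ρ l (fun q => g q a b) p = pderiv ρ l (fun q => h q a b) p :=
    pderiv_congr (fun q hq => by rw [hgh q hq]) hp
  simp only [christoffel, hd, hgh p hp]

lemma scalarCurvature_congr (hp : p ∈ strip ρ) :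
    scalarCurvature ρ g p = scalarCurvature ρ h p := by
  have hd (l k i j : Fin 2) : pderiv ρ l (christoffel ρ g k i j) p =
      pderiv ρ l (christoffel ρ h k i j) p :=
    pderiv_congr (fun q hq => christoffel_congr hgh hq k i j) hp
  simp only [scalarCurvature, ricci, hd, hgh p hp, christoffel_congr hgh hp]

lemma geodesicCurvature_congr (hp : p ∈ strip ρ) :
    geodesicCurvature ρ g p = geodesicCurvature ρ h p := by
  simp only [geodesicCurvature, outwardNormal, hgh p hp, christoffel_congr hgh hp]

end Congr

lemma stripBoundary_subset_strip {ρ : ℝ} (hρ : 0 < ρ) : stripBoundary ρ ⊆ strip ρ := by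
  intro p hp
  rw [mem_strip]; rcases hp with h | h <;> rw [h] <;> constructor <;> linarith

lemma IsSmoothMetric.scalarCurvature_periodic {ρ : ℝ} {g : TensorField} (hρ : 0 < ρ)
    (hg : IsSmoothMetric ρ g) (θ s : ℝ) (hs : s ∈ Set.Icc (-ρ) ρ) :
    scalarCurvature ρ g (θ + 2 * Real.pi, s) = scalarCurvature ρ g (θ, s) := by
  have h1 : ∀ l j k : Fin 2, ∀ θ s, s ∈ Set.Icc (-ρ) ρ →
      pderiv ρ l (fun q => g q j k) (θ + 2 * Real.pi, s) =
      pderiv ρ l (fun q => g q j k) (θ, s) := fun l j k =>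
    pderiv_periodic (fun θ s hs => by rw [hg.periodic θ s hs])
  have h2 : ∀ i l j k : Fin 2, pderiv ρ i (pderiv ρ l (fun q => g q j k)) (θ + 2 * Real.pi, s) =
      pderiv ρ i (pderiv ρ l (fun q => g q j k)) (θ, s) := fun i l j k =>
    pderiv_periodic (h1 l j k) θ s hs
  rw [hg.scalarCurvature_eq hρ ⟨trivial, hs⟩, hg.scalarCurvature_eq hρ ⟨trivial, hs⟩]
  simp only [h2, fun l j k => h1 l j k θ s hs, hg.periodic θ s hs]

/-! ### The unnormalised flow: conformality, monotonicity and the sign of `R`. -/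

namespace IsRicciFlow

variable {ρ : ℝ} {g₀ : TensorField} {T : EReal} {g : ℝ → TensorField}
  (H : IsRicciFlow ρ g₀ T g)

section
include H

lemma continuousOn_scalarCurvature (hρ : 0 < ρ) {τ : ℝ} (hτ : (τ : EReal) < T) :
    ContinuousOn (fun q : ℝ × (ℝ × ℝ) => scalarCurvature ρ (g q.1) q.2)
      (Set.Icc 0 τ ×ˢ strip ρ) := by
  have hlt : ∀ t ∈ Set.Icc 0 τ, (t : EReal) < T := fun t ht =>
    lt_of_le_of_lt (EReal.coe_le_coe_iff.2 ht.2) hτ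
  have hsub : Set.Icc 0 τ ×ˢ strip ρ ⊆ {t : ℝ | 0 ≤ t ∧ (t : EReal) < T} ×ˢ strip ρ :=
    fun q hq => ⟨⟨hq.1.1, hlt _ hq.1⟩, hq.2⟩
  have c0 (i j) := (H.continuous₀ i j).mono hsub
  have c1 (i j a) := (H.continuous₁ i j a).mono hsub
  have c2 (i j a b) := (H.continuous₂ i j a b).mono hsub
  refine ContinuousOn.congr ?_ (fun q hq =>
    (H.metric q.1 hq.1.1 (hlt _ hq.1)).scalarCurvature_eq hρ hq.2)
  refine ContinuousOn.div ?_ (by fun_prop) (fun q hq => pow_ne_zero 2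
    ((H.metric q.1 hq.1.1 (hlt _ hq.1)).disc_pos hq.2).ne')
  have a1 := c0 0 0
  have a2 := c0 0 1
  have a3 := c0 1 1
  have b1 := c1 0 0 0
  have b2 := c1 0 0 1
  have b3 := c1 0 1 0
  have b4 := c1 0 1 1
  have b5 := c1 1 1 0
  have b6 := c1 1 1 1
  have d1 := c2 0 1 0 1
  have d2 := c2 0 0 1 1
  have d3 := c2 1 1 0 0
  clear c0 c1 c2
  fun_prop

lemma exists_scalarCurvature_bound (hρ : 0 < ρ) {τ : ℝ} (hτ : (τ : EReal) < T) :
    ∃ C, 0 ≤ C ∧ ∀ t ∈ Set.Icc 0 τ, ∀ p ∈ strip ρ, |scalarCurvature ρ (g t) p| ≤ C := by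
  have hKc : IsCompact (Set.Icc 0 τ ×ˢ (Set.Icc 0 (2 * Real.pi) ×ˢ Set.Icc (-ρ) ρ)) :=
    isCompact_Icc.prod (isCompact_Icc.prod isCompact_Icc)
  obtain ⟨C, hC⟩ := hKc.exists_bound_of_continuousOn ((H.continuousOn_scalarCurvature hρ hτ).mono
    (Set.prod_mono subset_rfl (rectangle_subset_strip ρ)))
  refine ⟨max C 0, le_max_right _ _, fun t ht p hp => ?_⟩
  have hm := H.metric t ht.1 (lt_of_le_of_lt (EReal.coe_le_coe_iff.2 ht.2) hτ)
  obtain ⟨q, hq, hpq⟩ := exists_mem_Icc_of_periodic (hm.scalarCurvature_periodic hρ) hp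
  rw [hpq]
  exact (hC (t, q) ⟨ht, hq⟩).trans (le_max_left _ _)

/-- All components satisfy the same scalar linear equation `∂ g_{ij} = -R g_{ij}`, so their ratios
do not move. The mean value theorem carries this down to `t = 0`, where only continuity is
available. -/
lemma apply_mul_apply_zero {t : ℝ} (ht : 0 ≤ t) (htT : (t : EReal) < T) {p : ℝ × ℝ}
    (hp : p ∈ strip ρ) (i j : Fin 2) : g t p i j / g t p 0 0 = g 0 p i j / g 0 p 0 0 := by
  rcases ht.eq_or_lt with rfl | ht
  · rfl
  have hlt : ∀ s, s ≤ t → (s : EReal) < T := fun s hs =>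
    lt_of_le_of_lt (EReal.coe_le_coe_iff.2 hs) htT
  have hc (i j) : ContinuousOn (fun s => g s p i j) (Set.Icc 0 t) :=
    (H.continuous₀ i j).comp (f := fun s : ℝ => (s, p)) (by fun_prop)
      (fun s hs => ⟨⟨hs.1, hlt s hs.2⟩, hp⟩)
  obtain ⟨c, hc, hslope⟩ := exists_hasDerivAt_eq_slope (fun s => g s p i j / g s p 0 0) (fun _ => 0)
    ht ((hc i j).div (hc 0 0) fun s hs => ((H.metric s hs.1 (hlt s hs.2)).pos00 hp).ne')
    (fun s hs => by
      have h0 := ((H.metric s hs.1.le (hlt s hs.2.le)).pos00 hp).ne'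
      refine ((H.evolution s hs.1 (hlt s hs.2.le) p hp i j).div
        (H.evolution s hs.1 (hlt s hs.2.le) p hp 0 0) h0).congr_deriv ?_
      field_simp
      ring)
  have h3 : g t p i j / g t p 0 0 - g 0 p i j / g 0 p 0 0 = 0 := by
    rcases div_eq_zero_iff.1 hslope.symm with h | h
    · exact h
    · linarith
  linarith

lemma isConformal {a b : ℝ} (ha : 0 ≤ a) (haT : (a : EReal) < T) (hb : 0 ≤ b)
    (hbT : (b : EReal) < T) :
    IsConformal ρ (fun p => Real.log (g b p 0 0) - Real.log (g a p 0 0)) (g a) (g b) where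
  smooth := (((H.metric b hb hbT).smooth 0 0).log
      fun q hq => ((H.metric b hb hbT).pos00 hq).ne').sub
    (((H.metric a ha haT).smooth 0 0).log fun q hq => ((H.metric a ha haT).pos00 hq).ne')
  left := H.metric a ha haT
  right := H.metric b hb hbT
  eq p hp := by
    have hpa := (H.metric a ha haT).pos00 hp
    have hpb := (H.metric b hb hbT).pos00 hp
    ext i j
    have e1 := H.apply_mul_apply_zero ha haT hp i j
    have e2 := H.apply_mul_apply_zero hb hbT hp i j
    rw [← e1, div_eq_div_iff hpb.ne' hpa.ne'] at e2
    rw [Real.exp_sub, Real.exp_log hpa, Real.exp_log hpb]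
    change g b p i j = g b p 0 0 / g a p 0 0 * g a p i j
    field_simp
    linarith

lemma hasDerivAt_log {t : ℝ} (ht : 0 < t) (htT : (t : EReal) < T) {p : ℝ × ℝ}
    (hp : p ∈ strip ρ) :
    HasDerivAt (fun s => Real.log (g s p 0 0)) (-scalarCurvature ρ (g t) p) t := by
  have h0 := ((H.metric t ht.le htT).pos00 hp).ne'
  refine ((H.evolution t ht htT p hp 0 0).log h0).congr_deriv ?_
  field_simp

lemma continuousOn_log {τ : ℝ} (hτ : (τ : EReal) < T) :
    ContinuousOn (fun q : ℝ × (ℝ × ℝ) => Real.log (g q.1 q.2 0 0)) (Set.Icc 0 τ ×ˢ strip ρ) := by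
  have hlt : ∀ t ∈ Set.Icc 0 τ, (t : EReal) < T := fun t ht =>
    lt_of_le_of_lt (EReal.coe_le_coe_iff.2 ht.2) hτ
  exact ((H.continuous₀ 0 0).mono fun q hq => ⟨⟨hq.1.1, hlt _ hq.1⟩, hq.2⟩).log
    fun q hq => ((H.metric q.1 hq.1.1 (hlt _ hq.1)).pos00 hq.2).ne'

lemma geodesicCurvature_eq (hρ : 0 < ρ) {t : ℝ} (ht : 0 ≤ t) (htT : (t : EReal) < T) {p : ℝ × ℝ}
    (hp : p ∈ stripBoundary ρ) : geodesicCurvature ρ (g t) p = geodesicCurvature ρ g₀ p := by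
  rcases ht.eq_or_lt with rfl | ht
  · exact geodesicCurvature_congr H.initial (stripBoundary_subset_strip hρ hp)
  · exact H.boundary t ht htT p hp

variable (hρ : 0 < ρ) (hR : ∀ p ∈ strip ρ, 0 ≤ scalarCurvature ρ g₀ p)
  (hk : ∀ p ∈ stripBoundary ρ, geodesicCurvature ρ g₀ p ≤ 0)

include hρ hR hk

/-- The metric does not grow beyond the initial metric. -/
lemma log_le_log_zero {t : ℝ} (ht : 0 ≤ t) (htT : (t : EReal) < T) {p : ℝ × ℝ}
    (hp : p ∈ strip ρ) : Real.log (g t p 0 0) ≤ Real.log (g 0 p 0 0) := by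
  have hlt : ∀ s ∈ Set.Icc 0 t, (s : EReal) < T := fun s hs =>
    lt_of_le_of_lt (EReal.coe_le_coe_iff.2 hs.2) htT
  have hm0 := H.metric 0 le_rfl H.pos
  have := maximum_principle (ρ := ρ) (τ := t) (C := 0)
    (w := fun s p => Real.log (g s p 0 0) - Real.log (g 0 p 0 0))
    (w' := fun s p => -scalarCurvature ρ (g s) p)
    ((H.continuousOn_log htT).sub ((H.continuousOn_log htT).comp
      (f := fun q : ℝ × (ℝ × ℝ) => ((0 : ℝ), q.2)) (by fun_prop)
      fun q hq => ⟨⟨le_rfl, ht⟩, hq.2⟩))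
    (fun s hs θ x hx => by
      simp only [(H.metric s hs.1 (hlt s hs)).periodic θ x hx, hm0.periodic θ x hx])
    (fun p hp => by simp)
    (fun s hs p hp => (H.hasDerivAt_log hs.1 (hlt s ⟨hs.1.le, hs.2⟩) hp).sub_const _)
    (fun s hs p hp hmax hpos => by
      have hsT := hlt s ⟨hs.1.le, hs.2⟩
      have := (H.isConformal le_rfl H.pos hs.1.le hsT).scalarCurvature_le_of_max hρ
        (fun q hq => by
          rw [H.geodesicCurvature_eq hρ hs.1.le hsT hq, H.geodesicCurvature_eq hρ le_rfl H.pos hq])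
        (fun q hq => by
          rw [H.geodesicCurvature_eq hρ le_rfl H.pos hq]; exact hk q hq) hp hmax hpos
      rw [scalarCurvature_congr H.initial hp] at this
      -- At a positive maximum `0 ≤ R(g₀) ≤ eʷ R(g s)`, so `∂w = -R(g s) ≤ 0` and the constant `C =
      -- 0` suffices.
      have h2 := nonneg_of_mul_nonneg_right ((hR p hp).trans this) (Real.exp_pos _)
      linarith) t ⟨ht, le_rfl⟩ p hp
  linarith

/-- The metric is nonincreasing in time. -/
lemma log_antitone {t h : ℝ} (ht : 0 ≤ t) (hh : 0 ≤ h) (htT : ((t + h : ℝ) : EReal) < T)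
    {p : ℝ × ℝ} (hp : p ∈ strip ρ) : Real.log (g (t + h) p 0 0) ≤ Real.log (g t p 0 0) := by
  have hlt : ∀ s, s ≤ t + h → (s : EReal) < T := fun s hs =>
    lt_of_le_of_lt (EReal.coe_le_coe_iff.2 hs) htT
  have htT' := hlt t (by linarith)
  obtain ⟨C, hC, hCb⟩ := H.exists_scalarCurvature_bound hρ htT'
  -- The flow is compared with its shift by `h`; they are ordered initially by `log_le_log_zero`.
  have := maximum_principle (ρ := ρ) (τ := t) (C := C)
    (w := fun s p => Real.log (g (s + h) p 0 0) - Real.log (g s p 0 0))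
    (w' := fun s p => -scalarCurvature ρ (g (s + h)) p - -scalarCurvature ρ (g s) p)
    (((H.continuousOn_log htT).comp
      (f := fun q : ℝ × (ℝ × ℝ) => (q.1 + h, q.2)) (by fun_prop)
      fun q hq => ⟨⟨by linarith [hq.1.1], by linarith [hq.1.2]⟩, hq.2⟩).sub
      (H.continuousOn_log htT'))
    (fun s hs θ x hx => by
      simp only [(H.metric s hs.1 (hlt s (by linarith [hs.2]))).periodic θ x hx,
        (H.metric (s + h) (by linarith [hs.1]) (hlt _ (by linarith [hs.2]))).periodic θ x hx])
    (fun p hp => by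
      have := H.log_le_log_zero hρ hR hk (t := 0 + h) (by linarith) (hlt _ (by linarith)) hp
      linarith)
    (fun s hs p hp => by
      refine HasDerivAt.sub ?_ (H.hasDerivAt_log hs.1 (hlt s (by linarith [hs.2])) hp)
      exact (H.hasDerivAt_log (by linarith [hs.1]) (hlt (s + h) (by linarith [hs.2])) hp).comp_add_const s h)
    (fun s hs p hp hmax hpos => by
      have hsT := hlt s (by linarith [hs.2])
      have hsT' := hlt (s + h) (by linarith [hs.2])
      have hs0 : 0 ≤ s + h := by linarith [hs.1]
      have := (H.isConformal hs.1.le hsT hs0 hsT').scalarCurvature_le_of_max hρ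
        (fun q hq => by
          rw [H.geodesicCurvature_eq hρ hs.1.le hsT hq, H.geodesicCurvature_eq hρ hs0 hsT' hq])
        (fun q hq => by
          rw [H.geodesicCurvature_eq hρ hs.1.le hsT hq]; exact hk q hq) hp hmax hpos
      have hb := (le_abs_self _).trans (hCb s ⟨hs.1.le, hs.2⟩ p hp)
      beta_reduce at this hpos ⊢
      generalize Real.log (g (s + h) p 0 0) - Real.log (g s p 0 0) = w at *
      generalize scalarCurvature ρ (g (s + h)) p = R' at *
      generalize scalarCurvature ρ (g s) p = R at *
      -- Hence `R - R' ≤ (1 - e^(-w)) R ≤ C w`, from `R ≤ C` and `0 ≤ 1 - e^(-w) ≤ w`.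
      have h1 : Real.exp (-w) * R ≤ R' := by
        rw [Real.exp_neg, inv_mul_le_iff₀ (Real.exp_pos _)]; exact this
      have h2 : 1 - w ≤ Real.exp (-w) := by linarith [Real.add_one_le_exp (-w)]
      have h3 : Real.exp (-w) ≤ 1 := Real.exp_le_one_iff.2 (by linarith)
      nlinarith [mul_le_mul_of_nonneg_right hb (sub_nonneg.2 h3),
        mul_le_mul_of_nonneg_left h2 hC]) t ⟨ht, le_rfl⟩ p hp
  linarith

/-- `-R` is the time derivative of `log g₀₀`, which is nonincreasing. -/
lemma scalarCurvature_nonneg {t : ℝ} (ht : 0 < t) (htT : (t : EReal) < T) {p : ℝ × ℝ}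
    (hp : p ∈ strip ρ) : 0 ≤ scalarCurvature ρ (g t) p := by
  have := deriv_nonneg_of_max_right ht (H.hasDerivAt_log ht htT hp).neg (fun s hs => by
    have := H.log_antitone hρ hR hk (t := s) (h := t - s) hs.1 (by linarith [hs.2])
      (by simpa using htT) hp
    simp only [add_sub_cancel] at this
    simp only [Pi.neg_apply]
    linarith)
  linarith

end

end IsRicciFlow

/-! ### Integration on the cylinder, the divergence theorem and Gauss–Bonnet. -/

/-- The integral over a fundamental domain of the cylinder against `ds dθ`. -/
def cylInt (ρ : ℝ) (f : ℝ × ℝ → ℝ) : ℝ :=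
  ∫ θ in (0 : ℝ)..(2 * Real.pi), ∫ s in (-ρ)..ρ, f (θ, s)

/-- The integral of `f` over the boundary of the cylinder against `dθ`. -/
def bdryInt (ρ : ℝ) (f : ℝ × ℝ → ℝ) : ℝ :=
  (∫ θ in (0 : ℝ)..(2 * Real.pi), f (θ, ρ)) + ∫ θ in (0 : ℝ)..(2 * Real.pi), f (θ, -ρ)

section Integral

open MeasureTheory

variable {ρ : ℝ} {f h : ℝ × ℝ → ℝ}

lemma integrableOn_rectangle (hf : ContinuousOn f (strip ρ)) :
    IntegrableOn f (Set.Icc 0 (2 * Real.pi) ×ˢ Set.Icc (-ρ) ρ) :=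
  (hf.mono (rectangle_subset_strip ρ)).integrableOn_compact (isCompact_Icc.prod isCompact_Icc)

lemma cylInt_eq (hρ : 0 < ρ) (hf : ContinuousOn f (strip ρ)) :
    cylInt ρ f = ∫ q in Set.Icc 0 (2 * Real.pi) ×ˢ Set.Icc (-ρ) ρ, f q := by
  rw [Measure.volume_eq_prod, setIntegral_prod f (integrableOn_rectangle hf), cylInt,
    intervalIntegral.integral_of_le Real.two_pi_pos.le, integral_Icc_eq_integral_Ioc]
  congr 1
  ext θ
  rw [intervalIntegral.integral_of_le (by linarith), integral_Icc_eq_integral_Ioc]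

lemma cylInt_mono (hρ : 0 < ρ) (hf : ContinuousOn f (strip ρ)) (hh : ContinuousOn h (strip ρ))
    (hfh : ∀ q ∈ strip ρ, f q ≤ h q) : cylInt ρ f ≤ cylInt ρ h := by
  rw [cylInt_eq hρ hf, cylInt_eq hρ hh]
  exact setIntegral_mono_on (integrableOn_rectangle hf) (integrableOn_rectangle hh)
    (measurableSet_Icc.prod measurableSet_Icc) (fun q hq => hfh q (rectangle_subset_strip ρ hq))

lemma cylInt_congr (hρ : 0 < ρ) (hfh : ∀ q ∈ strip ρ, f q = h q) : cylInt ρ f = cylInt ρ h := by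
  refine intervalIntegral.integral_congr fun θ _ => intervalIntegral.integral_congr fun s hs => ?_
  rw [Set.uIcc_of_le (by linarith)] at hs
  exact hfh _ ⟨trivial, hs⟩

lemma cylInt_add (hρ : 0 < ρ) (hf : ContinuousOn f (strip ρ)) (hh : ContinuousOn h (strip ρ)) :
    cylInt ρ (fun q => f q + h q) = cylInt ρ f + cylInt ρ h := by
  rw [cylInt_eq hρ hf, cylInt_eq hρ hh, cylInt_eq (f := fun q => f q + h q) hρ (hf.add hh)]
  exact integral_add (integrableOn_rectangle hf) (integrableOn_rectangle hh)

lemma cylInt_const_mul (c : ℝ) : cylInt ρ (fun q => c * f q) = c * cylInt ρ f := by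
  simp only [cylInt, intervalIntegral.integral_const_mul]

lemma cylInt_le_combination (hρ : 0 < ρ) {u : ℝ × ℝ → ℝ} (a b : ℝ)
    (hf : ContinuousOn f (strip ρ)) (hh : ContinuousOn h (strip ρ)) (hu : ContinuousOn u (strip ρ))
    (hle : ∀ q ∈ strip ρ, f q ≤ a * h q + b * u q) :
    cylInt ρ f ≤ a * cylInt ρ h + b * cylInt ρ u := by
  rw [← cylInt_const_mul, ← cylInt_const_mul]
  have h1 : ContinuousOn (fun q => a * h q) (strip ρ) := continuousOn_const.mul hh
  have h2 : ContinuousOn (fun q => b * u q) (strip ρ) := continuousOn_const.mul hu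
  rw [← cylInt_add hρ h1 h2]
  exact cylInt_mono hρ hf (h1.add h2) hle

lemma cylInt_nonneg (hρ : 0 < ρ) (hf : ∀ q ∈ strip ρ, 0 ≤ f q) : 0 ≤ cylInt ρ f :=
  intervalIntegral.integral_nonneg Real.two_pi_pos.le fun _ _ =>
    intervalIntegral.integral_nonneg (by linarith) fun _ hs => hf _ ⟨trivial, hs⟩

lemma continuous_slice (hf : ContinuousOn f (strip ρ)) {s : ℝ} (hs : s ∈ Set.Icc (-ρ) ρ) :
    Continuous fun θ => f (θ, s) :=
  hf.comp_continuous (by fun_prop) fun _ => ⟨trivial, hs⟩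

lemma bdryInt_mono (hρ : 0 < ρ) (hf : ContinuousOn f (strip ρ)) (hh : ContinuousOn h (strip ρ))
    (hfh : ∀ q ∈ stripBoundary ρ, f q ≤ h q) : bdryInt ρ f ≤ bdryInt ρ h := by
  have hs1 : ρ ∈ Set.Icc (-ρ) ρ := ⟨by linarith, le_rfl⟩
  have hs2 : -ρ ∈ Set.Icc (-ρ) ρ := ⟨le_rfl, by linarith⟩
  refine add_le_add ?_ ?_
  · exact intervalIntegral.integral_mono Real.two_pi_pos.le
      ((continuous_slice hf hs1).intervalIntegrable _ _)
      ((continuous_slice hh hs1).intervalIntegrable _ _) fun θ => hfh _ (Or.inr rfl)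
  · exact intervalIntegral.integral_mono Real.two_pi_pos.le
      ((continuous_slice hf hs2).intervalIntegrable _ _)
      ((continuous_slice hh hs2).intervalIntegrable _ _) fun θ => hfh _ (Or.inl rfl)

lemma bdryInt_const_mul (c : ℝ) : bdryInt ρ (fun q => c * f q) = c * bdryInt ρ f := by
  simp only [bdryInt, intervalIntegral.integral_const_mul, mul_add]

lemma bdryInt_congr (hfh : ∀ q ∈ stripBoundary ρ, f q = h q) : bdryInt ρ f = bdryInt ρ h := by
  rw [bdryInt, bdryInt]
  congr 1
  · exact intervalIntegral.integral_congr fun θ _ => hfh _ (Or.inr rfl)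
  · exact intervalIntegral.integral_congr fun θ _ => hfh _ (Or.inl rfl)

lemma bdryInt_nonneg (hf : ∀ q ∈ stripBoundary ρ, 0 ≤ f q) : 0 ≤ bdryInt ρ f :=
  add_nonneg
    (intervalIntegral.integral_nonneg Real.two_pi_pos.le fun _ _ => hf _ (Or.inr rfl))
    (intervalIntegral.integral_nonneg Real.two_pi_pos.le fun _ _ => hf _ (Or.inl rfl))

/-- The divergence theorem on the cylinder. -/
lemma cylInt_divergence (hρ : 0 < ρ) {X Y : ℝ × ℝ → ℝ} (hX : ContDiffOn ℝ ∞ X (strip ρ))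
    (hY : ContDiffOn ℝ ∞ Y (strip ρ))
    (hper : ∀ θ s, s ∈ Set.Icc (-ρ) ρ → X (θ + 2 * Real.pi, s) = X (θ, s)) :
    cylInt ρ (fun q => pderiv ρ 0 X q + pderiv ρ 1 Y q) =
      bdryInt ρ (fun q => Real.sign q.2 * Y q) := by
  have huIcc : Set.uIcc (0 : ℝ) (2 * Real.pi) ×ˢ Set.uIcc (-ρ) ρ =
      Set.Icc 0 (2 * Real.pi) ×ˢ Set.Icc (-ρ) ρ := by
    rw [Set.uIcc_of_le Real.two_pi_pos.le, Set.uIcc_of_le (by linarith)]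
  have hnhds : ∀ x ∈ Set.Ioo (min 0 (2 * Real.pi)) (max 0 (2 * Real.pi)) ×ˢ
      Set.Ioo (min (-ρ) ρ) (max (-ρ) ρ), strip ρ ∈ nhds x := by
    intro x hx
    rw [← mem_interior_iff_mem_nhds, interior_strip]
    have := hx.2
    rw [min_eq_left (by linarith), max_eq_right (by linarith)] at this
    exact ⟨trivial, this⟩
  have hsub := rectangle_subset_strip ρ
  have key := integral2_divergence_prod_of_hasFDerivAt X Y
    (fun q => fderivWithin ℝ X (strip ρ) q) (fun q => fderivWithin ℝ Y (strip ρ) q)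
    0 (-ρ) (2 * Real.pi) ρ
    (by rw [huIcc]; exact hX.continuousOn.mono hsub)
    (by rw [huIcc]; exact hY.continuousOn.mono hsub)
    (fun x hx => ((hX.differentiableOn (by simp) x
      (mem_of_mem_nhds (hnhds x hx))).hasFDerivWithinAt).hasFDerivAt (hnhds x hx))
    (fun x hx => ((hY.differentiableOn (by simp) x
      (mem_of_mem_nhds (hnhds x hx))).hasFDerivWithinAt).hasFDerivAt (hnhds x hx))
    (by
      rw [huIcc]
      exact integrableOn_rectangle (f := fun q => pderiv ρ 0 X q + pderiv ρ 1 Y q)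
        ((contDiffOn_pderiv hρ hX 0).continuousOn.add (contDiffOn_pderiv hρ hY 1).continuousOn))
  have hXp : (∫ s in (-ρ)..ρ, X (2 * Real.pi, s)) = ∫ s in (-ρ)..ρ, X (0, s) := by
    refine intervalIntegral.integral_congr fun s hs => ?_
    rw [Set.uIcc_of_le (by linarith)] at hs
    simpa using hper 0 s hs
  refine Eq.trans (b := _) ?_ (key.trans ?_)
  · rfl
  · rw [hXp, bdryInt]
    simp only [Real.sign_of_pos hρ, Real.sign_of_neg (neg_neg_of_pos hρ), one_mul, neg_mul,
      intervalIntegral.integral_neg]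
    ring

lemma exists_bound_of_periodic (hf : ContinuousOn f (strip ρ))
    (hper : ∀ θ s, s ∈ Set.Icc (-ρ) ρ → f (θ + 2 * Real.pi, s) = f (θ, s)) :
    ∃ C, 0 < C ∧ ∀ q ∈ strip ρ, |f q| ≤ C := by
  obtain ⟨C, hC⟩ := (isCompact_Icc.prod isCompact_Icc).exists_bound_of_continuousOn
    (hf.mono (rectangle_subset_strip ρ))
  refine ⟨max C 1, by positivity, fun q hq => ?_⟩
  obtain ⟨r, hr, hqr⟩ := exists_mem_Icc_of_periodic hper hq
  rw [hqr]
  exact (hC r hr).trans (le_max_left _ _)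

end Integral

lemma IsSmoothMetric.continuousOn_scalarCurvature_density {ρ : ℝ} {g : TensorField} (hρ : 0 < ρ)
    (hg : IsSmoothMetric ρ g) :
    ContinuousOn (fun q => scalarCurvature ρ g q * Real.sqrt (g q).det) (strip ρ) :=
  ((contDiffOn_pderiv hρ (hg.contDiffOn_curvatureFlux hρ 0) 0).continuousOn.add
    (contDiffOn_pderiv hρ (hg.contDiffOn_curvatureFlux hρ 1) 1).continuousOn).congr
    fun _ hq => hg.scalarCurvature_mul_sqrt_det hρ hq

/-- The Gauss--Bonnet formula on the cylinder. -/
lemma IsSmoothMetric.totalScalarCurvature_eq {ρ : ℝ} {g : TensorField} (hρ : 0 < ρ)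
    (hg : IsSmoothMetric ρ g) : totalScalarCurvature ρ g =
      bdryInt ρ (fun q => -2 * (geodesicCurvature ρ g q * Real.sqrt (g q 0 0))) := by
  have h1 : totalScalarCurvature ρ g =
      cylInt ρ (fun q => scalarCurvature ρ g q * Real.sqrt (g q).det) := rfl
  rw [h1, cylInt_congr hρ (fun q hq => hg.scalarCurvature_mul_sqrt_det hρ hq),
    cylInt_divergence hρ (hg.contDiffOn_curvatureFlux hρ 0) (hg.contDiffOn_curvatureFlux hρ 1)
      (hg.curvatureFlux_periodic 0)]
  refine bdryInt_congr fun q hq => ?_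
  rw [hg.geodesicCurvature_mul hρ hq]
  ring

/-- The factor `s / ρ` agrees with the sign on the boundary but is continuous on the whole strip, as
`bdryInt_mono` requires. -/
lemma IsSmoothMetric.div_mul_curvatureFlux {ρ : ℝ} {g : TensorField} (hρ : 0 < ρ)
    (hg : IsSmoothMetric ρ g) {q : ℝ × ℝ} (hq : q ∈ stripBoundary ρ) :
    q.2 / ρ * curvatureFlux ρ g 1 q = -2 * (geodesicCurvature ρ g q * Real.sqrt (g q 0 0)) := by
  rw [hg.geodesicCurvature_mul hρ hq]
  rcases hq with hq | hq
  · rw [hq, Real.sign_of_neg (neg_neg_of_pos hρ)]; field_simp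
  · rw [hq, Real.sign_of_pos hρ]; field_simp

/-! ### Energy and trace estimates: total scalar curvature against area. -/

namespace IsConformal

variable {ρ : ℝ} {g h : TensorField} {w : ℝ × ℝ → ℝ}

lemma periodic (H : IsConformal ρ w g h) (θ s : ℝ) (hs : s ∈ Set.Icc (-ρ) ρ) :
    w (θ + 2 * Real.pi, s) = w (θ, s) := by
  have e1 := H.apply (p := (θ + 2 * Real.pi, s)) ⟨trivial, hs⟩ 0 0
  have e2 := H.apply (p := (θ, s)) ⟨trivial, hs⟩ 0 0
  have hp := H.left.pos00 (p := (θ, s)) ⟨trivial, hs⟩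
  rw [H.right.periodic θ s hs, H.left.periodic θ s hs, e2] at e1
  exact (Real.exp_injective (mul_right_cancel₀ hp.ne' e1)).symm

lemma sq_pderiv_le (H : IsConformal ρ w g h) {p : ℝ × ℝ} (hp : p ∈ strip ρ) :
    pderiv ρ 1 w p ^ 2 ≤ g p 1 1 / Real.sqrt (g p).det *
      (pderiv ρ 0 w p * gradFlux ρ g w 0 p + pderiv ρ 1 w p * gradFlux ρ g w 1 p) := by
  have hr := H.left.sqrt_det_pos hp
  have hr2 := Real.sq_sqrt (H.left.posDef p hp).det_pos.le
  rw [H.left.gradFlux_zero_eq hp, H.left.gradFlux_one_eq hp]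
  have hd := H.left.det_eq hp
  generalize Real.sqrt (g p).det = r at *
  rw [hd] at hr2
  have e : g p 1 1 / r * (pderiv ρ 0 w p * ((g p 1 1 * pderiv ρ 0 w p - g p 0 1 * pderiv ρ 1 w p) / r) +
      pderiv ρ 1 w p * ((g p 0 0 * pderiv ρ 1 w p - g p 0 1 * pderiv ρ 0 w p) / r)) =
      ((g p 1 1 * pderiv ρ 0 w p - g p 0 1 * pderiv ρ 1 w p) ^ 2 +
        r ^ 2 * pderiv ρ 1 w p ^ 2) / r ^ 2 := by
    field_simp
    linear_combination -(pderiv ρ 1 w p ^ 2) * hr2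
  rw [e, le_div_iff₀ (by positivity)]
  nlinarith [sq_nonneg (g p 1 1 * pderiv ρ 0 w p - g p 0 1 * pderiv ρ 1 w p)]

variable (H : IsConformal ρ w g h) (hρ : 0 < ρ)
  (hk : ∀ q ∈ stripBoundary ρ, geodesicCurvature ρ h q = geodesicCurvature ρ g q)
  (hk0 : ∀ q ∈ stripBoundary ρ, geodesicCurvature ρ g q ≤ 0)
  (hw : ∀ q ∈ strip ρ, w q ≤ 0)

include H hρ

/-- In Gauss–Bonnet only the length element changes, by `e^(w/2)`. With `g` fixed, `h` therefore
enters through `w` alone. -/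
lemma totalScalarCurvature_eq_of_eq
    (hk : ∀ q ∈ stripBoundary ρ, geodesicCurvature ρ h q = geodesicCurvature ρ g q) :
    totalScalarCurvature ρ h =
      bdryInt ρ (fun q => q.2 / ρ * curvatureFlux ρ g 1 q * Real.exp (w q / 2)) := by
  rw [H.right.totalScalarCurvature_eq hρ]
  refine bdryInt_congr fun q hq => ?_
  rw [hk q hq, H.apply (stripBoundary_subset_strip hρ hq), Real.sqrt_mul (Real.exp_pos _).le,
    ← Real.exp_half, H.left.div_mul_curvatureFlux hρ hq]
  ring

include hk hk0 hw

/-- A weighted energy estimate for the logarithm of the conformal factor. -/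
lemma energy_le (hR : ∀ q ∈ strip ρ, 0 ≤ scalarCurvature ρ g q)
    (hR' : ∀ q ∈ strip ρ, 0 ≤ scalarCurvature ρ h q) :
    cylInt ρ (fun q => Real.exp (w q / 2) *
      (pderiv ρ 0 w q * gradFlux ρ g w 0 q + pderiv ρ 1 w q * gradFlux ρ g w 1 q)) ≤
      2 * totalScalarCurvature ρ g := by
  have hexp : ContDiffOn ℝ ∞ (fun q => Real.exp (w q / 2)) (strip ρ) :=
    (H.smooth.div_const 2).exp
  -- The test function `1 - e^(w/2)` lies in `[0, 1]`, its gradient produces the weighted energy,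
  -- and it matches the factor in the boundary condition for `w`.
  have hX (i : Fin 2) : ContDiffOn ℝ ∞ (fun q => (1 - Real.exp (w q / 2)) * gradFlux ρ g w i q)
      (strip ρ) :=
    (contDiffOn_const.sub hexp).mul (H.left.contDiffOn_gradFlux hρ H.smooth i)
  have hdX (i : Fin 2) {q : ℝ × ℝ} (hq : q ∈ strip ρ) :
      pderiv ρ i (fun q => (1 - Real.exp (w q / 2)) * gradFlux ρ g w i q) q =
        (1 - Real.exp (w q / 2)) * pderiv ρ i (gradFlux ρ g w i) q -
          1 / 2 * (Real.exp (w q / 2) * (pderiv ρ i w q * gradFlux ρ g w i q)) := by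
    have e := (((HasPD.const hρ hq 1).sub hρ hq
      (((hasPD_of_contDiffOn H.smooth i hq).div hρ hq (HasPD.const hρ hq 2) two_ne_zero).exp
        hρ hq)).mul hρ hq (hasPD_of_contDiffOn (H.left.contDiffOn_gradFlux hρ H.smooth i) i hq)).2
    rw [e]
    ring
  have hdiv := cylInt_divergence hρ (hX 0) (hX 1) (fun θ s hs => by
    simp only [H.periodic θ s hs, H.left.gradFlux_periodic H.periodic 0 θ s hs])
  have hexp1 {q : ℝ × ℝ} (hq : q ∈ strip ρ) : Real.exp (w q / 2) ≤ 1 :=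
    Real.exp_le_one_iff.2 (by linarith [hw q hq])
  -- The outward flux of `w` is `2 √g₀₀ k (e^(w/2) - 1)`, a product of two nonpositive factors, so
  -- the boundary term can be dropped.
  have hbd := bdryInt_nonneg (ρ := ρ)
    (f := fun q => Real.sign q.2 * ((1 - Real.exp (w q / 2)) * gradFlux ρ g w 1 q)) (by
    intro q hq
    have e := H.sign_mul_gradFlux hρ hq
    rw [hk q hq] at e
    have h1 := hexp1 (stripBoundary_subset_strip hρ hq)
    rw [mul_left_comm, e]
    refine mul_nonneg (by linarith) (mul_nonneg (by positivity) ?_)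
    nlinarith [hk0 q hq])
  have hden := H.left.continuousOn_scalarCurvature_density hρ
  have hQ : ContinuousOn (fun q => Real.exp (w q / 2) *
      (pderiv ρ 0 w q * gradFlux ρ g w 0 q + pderiv ρ 1 w q * gradFlux ρ g w 1 q)) (strip ρ) :=
    hexp.continuousOn.mul
      (((contDiffOn_pderiv hρ H.smooth 0).mul
          (H.left.contDiffOn_gradFlux hρ H.smooth 0)).continuousOn.add
        ((contDiffOn_pderiv hρ H.smooth 1).mul
          (H.left.contDiffOn_gradFlux hρ H.smooth 1)).continuousOn)
  have hQ2 : ContinuousOn (fun q => 1 / 2 * (Real.exp (w q / 2) *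
      (pderiv ρ 0 w q * gradFlux ρ g w 0 q + pderiv ρ 1 w q * gradFlux ρ g w 1 q))) (strip ρ) :=
    continuousOn_const.mul hQ
  have hdc : ContinuousOn (fun q =>
      pderiv ρ 0 (fun q => (1 - Real.exp (w q / 2)) * gradFlux ρ g w 0 q) q +
      pderiv ρ 1 (fun q => (1 - Real.exp (w q / 2)) * gradFlux ρ g w 1 q) q) (strip ρ) :=
    (contDiffOn_pderiv hρ (hX 0) 0).continuousOn.add (contDiffOn_pderiv hρ (hX 1) 1).continuousOn
  -- The density of `Δw` is that of `R(g)` minus that of `R(h)`. Multiplied by a number in `[0, 1]`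
  -- it stays below the density of `R(g)`, as both curvatures are nonnegative.
  have hmono := cylInt_mono hρ (hdc.add (hQ2)) hden (fun q hq => by
    simp only [Pi.add_apply, hdX 0 hq, hdX 1 hq]
    have e := H.scalarCurvature_mul_sqrt_det hρ hq
    have s1 : 0 ≤ scalarCurvature ρ h q * Real.sqrt (h q).det :=
      mul_nonneg (hR' q hq) (Real.sqrt_nonneg _)
    have s0 : 0 ≤ scalarCurvature ρ g q * Real.sqrt (g q).det :=
      mul_nonneg (hR q hq) (Real.sqrt_nonneg _)
    have x0 := Real.exp_pos (w q / 2)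
    have x1 := hexp1 hq
    generalize pderiv ρ 0 (gradFlux ρ g w 0) q = d0 at *
    generalize pderiv ρ 1 (gradFlux ρ g w 1) q = d1 at *
    generalize scalarCurvature ρ g q * Real.sqrt (g q).det = S at *
    generalize Real.exp (w q / 2) = x at *
    nlinarith [mul_nonneg (sub_nonneg.2 x1) (s1.trans_eq e)])
  have hadd := cylInt_add hρ hdc (hQ2)
  rw [cylInt_const_mul, hdiv] at hadd
  have : totalScalarCurvature ρ g =
      cylInt ρ (fun q => scalarCurvature ρ g q * Real.sqrt (g q).det) := rfl
  rw [this]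
  have e : cylInt ρ (fun q =>
      pderiv ρ 0 (fun q => (1 - Real.exp (w q / 2)) * gradFlux ρ g w 0 q) q +
      pderiv ρ 1 (fun q => (1 - Real.exp (w q / 2)) * gradFlux ρ g w 1 q) q +
      1 / 2 * (Real.exp (w q / 2) *
        (pderiv ρ 0 w q * gradFlux ρ g w 0 q + pderiv ρ 1 w q * gradFlux ρ g w 1 q))) ≤
      cylInt ρ (fun q => scalarCurvature ρ g q * Real.sqrt (g q).det) := hmono
  linarith

end IsConformal

lemma hasPD_snd {ρ : ℝ} (hρ : 0 < ρ) {p : ℝ × ℝ} (hp : p ∈ strip ρ) :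
    HasPD ρ 1 (fun q => q.2) p 1 := by
  have := HasPD.of_hasFDerivWithinAt (i := 1) hρ hp
    (hasFDerivWithinAt_snd (𝕜 := ℝ) (p := p) (s := strip ρ))
  simpa [coordVec] using this

/-- A trace estimate. -/
lemma bdryInt_exp_half {ρ : ℝ} (hρ : 0 < ρ) {w : ℝ × ℝ → ℝ} (hw : ContDiffOn ℝ ∞ w (strip ρ)) :
    bdryInt ρ (fun q => Real.exp (w q / 2)) =
      cylInt ρ (fun q => 1 / ρ * Real.exp (w q / 2) +
        q.2 / ρ * (Real.exp (w q / 2) * (pderiv ρ 1 w q / 2))) := by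
  have hY : ContDiffOn ℝ ∞ (fun q : ℝ × ℝ => q.2 / ρ * Real.exp (w q / 2)) (strip ρ) :=
    (contDiffOn_snd.div_const ρ).mul (hw.div_const 2).exp
  have hdiv := cylInt_divergence hρ (contDiffOn_const (c := (0 : ℝ))) hY (fun _ _ _ => rfl)
  rw [cylInt_congr hρ (h := fun q => 1 / ρ * Real.exp (w q / 2) +
        q.2 / ρ * (Real.exp (w q / 2) * (pderiv ρ 1 w q / 2)))] at hdiv
  · rw [hdiv]
    refine bdryInt_congr fun q hq => ?_
    rcases hq with hq | hq
    · rw [hq, Real.sign_of_neg (neg_neg_of_pos hρ)]; field_simp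
    · rw [hq, Real.sign_of_pos hρ]; field_simp
  · intro q hq
    have e := (((hasPD_snd hρ hq).div hρ hq (HasPD.const hρ hq ρ) hρ.ne').mul hρ hq
      (((hasPD_of_contDiffOn hw 1 hq).div hρ hq (HasPD.const hρ hq 2) two_ne_zero).exp hρ hq)).2
    rw [e, (HasPD.const (i := 0) hρ hq 0).2]
    field_simp
    ring

/-- `F(h)` is at most a constant times `∫ e^(w/2)` over the boundary. With `y = A(h)^(1/4)`, the
trace identity and Young's inequality bound this by `(1/ρ + 1/(4y)) ∫ e^(w/2)` plus `y` times the
energy; since `∫ e^(w/2)` is of order `A(h)^(1/2) = y²`, both terms are of order `y`. The constant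
is chosen before `w` and `h`, which is what makes the final bound uniform in time and over all
flows. -/
lemma exists_totalScalarCurvature_le {ρ : ℝ} (hρ : 0 < ρ) {g : TensorField}
    (hg : IsSmoothMetric ρ g) (hR : ∀ q ∈ strip ρ, 0 ≤ scalarCurvature ρ g q)
    (hk0 : ∀ q ∈ stripBoundary ρ, geodesicCurvature ρ g q ≤ 0) :
    ∃ C, 0 < C ∧ ∀ (w : ℝ × ℝ → ℝ) (h : TensorField), IsConformal ρ w g h →
      (∀ q ∈ stripBoundary ρ, geodesicCurvature ρ h q = geodesicCurvature ρ g q) →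
      (∀ q ∈ strip ρ, w q ≤ 0) → (∀ q ∈ strip ρ, 0 ≤ scalarCurvature ρ h q) →
      ∀ y, 0 < y → y ^ 4 = area ρ h → totalScalarCurvature ρ h ≤ C * y := by
  have hr0 : ∀ q ∈ strip ρ, Real.sqrt (g q).det ≠ 0 := fun q hq => (hg.sqrt_det_pos hq).ne'
  obtain ⟨B, hB, hBb⟩ := exists_bound_of_periodic (hg.contDiffOn_curvatureFlux hρ 1).continuousOn
    (hg.curvatureFlux_periodic 1)
  obtain ⟨l, hl, hlb⟩ := exists_bound_of_periodic
    ((hg.smooth 1 1).div hg.contDiffOn_sqrt_det hr0).continuousOn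
    (fun θ s hs => by simp only [Pi.div_apply, hg.periodic θ s hs])
  obtain ⟨m, hm, hmb⟩ := exists_bound_of_periodic
    ((contDiffOn_const (c := (1 : ℝ))).div hg.contDiffOn_sqrt_det hr0).continuousOn
    (fun θ s hs => by simp only [Pi.div_apply, hg.periodic θ s hs])
  have hA0 : 0 ≤ area ρ g :=
    cylInt_nonneg (f := fun q => 1 * Real.sqrt (g q).det) hρ fun q _ => by positivity
  have hS0 : 0 ≤ totalScalarCurvature ρ g :=
    cylInt_nonneg (f := fun q => scalarCurvature ρ g q * Real.sqrt (g q).det) hρ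
      fun q hq => mul_nonneg (hR q hq) (Real.sqrt_nonneg _)
  have hJ0 : 0 ≤ cylInt ρ (fun _ => 1) := cylInt_nonneg hρ fun _ _ => zero_le_one
  -- `B`, `l` and `m` bound the curvature flux, `g₁₁ / √det g` and `1 / √det g`; the first summand
  -- comes from `step3`, the second from the energy.
  refine ⟨B * (((1 + area ρ g) / ρ + 1 / 4) / 2 * (cylInt ρ (fun _ => 1) + m) +
    l / 2 * totalScalarCurvature ρ g), by positivity, ?_⟩
  intro w h H hk hw hR' y hy hyA
  have hexp : ContinuousOn (fun q => Real.exp (w q / 2)) (strip ρ) :=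
    (H.smooth.div_const 2).exp.continuousOn
  have hw1 := (contDiffOn_pderiv hρ H.smooth 1).continuousOn
  have hQ : ContinuousOn (fun q => Real.exp (w q / 2) *
      (pderiv ρ 0 w q * gradFlux ρ g w 0 q + pderiv ρ 1 w q * gradFlux ρ g w 1 q)) (strip ρ) :=
    hexp.mul
      (((contDiffOn_pderiv hρ H.smooth 0).mul
          (H.left.contDiffOn_gradFlux hρ H.smooth 0)).continuousOn.add
        ((contDiffOn_pderiv hρ H.smooth 1).mul
          (H.left.contDiffOn_gradFlux hρ H.smooth 1)).continuousOn)
  have hrh : ContinuousOn (fun q => 1 * Real.sqrt (h q).det) (strip ρ) :=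
    continuousOn_const.mul H.right.contDiffOn_sqrt_det.continuousOn
  have harea : area ρ h = cylInt ρ (fun q => 1 * Real.sqrt (h q).det) := rfl
  -- Used to absorb the term `y / ρ`, which carries one power of `y` too many, into the constant.
  have hy1 : y ≤ 1 + area ρ g := by
    have hle : area ρ h ≤ area ρ g := by
      refine cylInt_mono hρ hrh (continuousOn_const.mul hg.contDiffOn_sqrt_det.continuousOn)
        fun q hq => ?_
      change 1 * Real.sqrt (h q).det ≤ 1 * Real.sqrt (g q).det
      rw [one_mul, one_mul, H.sqrt_det hq]
      exact mul_le_of_le_one_left (Real.sqrt_nonneg _) (Real.exp_le_one_iff.2 (hw q hq))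
    rw [← hyA] at hle
    by_contra! hcon
    have h1 : 1 ≤ y := by linarith
    have h2 : y ^ 1 ≤ y ^ 4 := pow_le_pow_right₀ h1 (by norm_num)
    linarith
  have step1 : totalScalarCurvature ρ h ≤ B * bdryInt ρ (fun q => Real.exp (w q / 2)) := by
    rw [H.totalScalarCurvature_eq_of_eq hρ hk, ← bdryInt_const_mul]
    have hP := (hg.contDiffOn_curvatureFlux hρ 1).continuousOn
    refine bdryInt_mono hρ (((by fun_prop : ContinuousOn (fun q : ℝ × ℝ => q.2 / ρ) (strip ρ)).mul
      hP).mul hexp) (continuousOn_const.mul hexp) fun q hq => ?_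
    have hb := abs_le.1 (hBb q (stripBoundary_subset_strip hρ hq))
    refine mul_le_mul_of_nonneg_right ?_ (Real.exp_pos _).le
    rcases hq with hq | hq
    · rw [hq, neg_div, div_self hρ.ne']; linarith
    · rw [hq, div_self hρ.ne']; linarith
  have step2 : bdryInt ρ (fun q => Real.exp (w q / 2)) ≤
      (1 / ρ + 1 / (4 * y)) * cylInt ρ (fun q => Real.exp (w q / 2)) +
        l * y / 4 * (2 * totalScalarCurvature ρ g) := by
    rw [bdryInt_exp_half hρ H.smooth]
    refine le_trans ?_ (add_le_add_right (mul_le_mul_of_nonneg_left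
      (H.energy_le hρ hk hk0 hw hR hR') (by positivity)) _)
    refine cylInt_le_combination hρ _ _ ((continuousOn_const.mul hexp).add
      ((by fun_prop : ContinuousOn (fun q : ℝ × ℝ => q.2 / ρ) (strip ρ)).mul
        (hexp.mul (hw1.div_const 2)))) hexp hQ fun q hq => ?_
    have hsq := H.sq_pderiv_le hq
    have hgr : 0 < g q 1 1 / Real.sqrt (g q).det := div_pos (hg.pos11 hq) (hg.sqrt_det_pos hq)
    have hl' : g q 1 1 / Real.sqrt (g q).det ≤ l := (le_abs_self _).trans (hlb q hq)
    have hx := Real.exp_pos (w q / 2)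
    have hs : |q.2 / ρ| ≤ 1 := by
      rw [abs_div, abs_of_pos hρ, div_le_one hρ, abs_le]; exact mem_strip.1 hq
    generalize pderiv ρ 0 w q * gradFlux ρ g w 0 q + pderiv ρ 1 w q * gradFlux ρ g w 1 q = Q at *
    generalize g q 1 1 / Real.sqrt (g q).det = a at *
    generalize Real.exp (w q / 2) = x at *
    generalize pderiv ρ 1 w q = v at *
    generalize q.2 / ρ = σ at *
    have hQ0 : 0 ≤ Q := by
      by_contra! hcon
      nlinarith [sq_nonneg v, mul_neg_of_pos_of_neg hgr hcon]
    have hv : v ^ 2 ≤ l * Q := hsq.trans (mul_le_mul_of_nonneg_right hl' hQ0)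
    have h1 : σ * v ≤ |v| := by
      calc σ * v ≤ |σ * v| := le_abs_self _
        _ = |σ| * |v| := abs_mul _ _
        _ ≤ 1 * |v| := mul_le_mul_of_nonneg_right hs (abs_nonneg _)
        _ = |v| := one_mul _
    -- Young's inequality with weight `y`, balancing the energy against `∫ e^(w/2) / y`.
    have h2 : |v| ≤ (y * v ^ 2 + 1 / y) / 2 := by
      have : (y * v ^ 2 + 1 / y) / 2 - |v| = (y * |v| - 1) ^ 2 / (2 * y) := by
        rw [← sq_abs v]; field_simp; ring
      have h3 : 0 ≤ (y * |v| - 1) ^ 2 / (2 * y) := by positivity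
      linarith
    have h3 : σ * v ≤ (y * (l * Q) + 1 / y) / 2 := by
      have := mul_le_mul_of_nonneg_left hv hy.le
      linarith
    have h4 := mul_le_mul_of_nonneg_left h3 hx.le
    have e1 : (1 / ρ + 1 / (4 * y)) * x + l * y / 4 * (x * Q) =
        1 / ρ * x + x * ((y * (l * Q) + 1 / y) / 2) / 2 := by
      field_simp
      ring
    change 1 / ρ * x + σ * (x * (v / 2)) ≤ (1 / ρ + 1 / (4 * y)) * x + l * y / 4 * (x * Q)
    rw [e1]
    linarith
  have step3 : cylInt ρ (fun q => Real.exp (w q / 2)) ≤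
      y ^ 2 / 2 * (cylInt ρ (fun _ => 1) + m) := by
    have e : y ^ 2 / 2 * (cylInt ρ (fun _ => 1) + m) =
        y ^ 2 / 2 * cylInt ρ (fun _ => 1) + m / (2 * y ^ 2) * area ρ h := by
      rw [← hyA]; field_simp
    rw [e, harea]
    refine cylInt_le_combination hρ _ _ hexp continuousOn_const hrh fun q hq => ?_
    have hm' : 1 / Real.sqrt (g q).det ≤ m := (le_abs_self _).trans (hmb q hq)
    rw [div_le_iff₀ (hg.sqrt_det_pos hq)] at hm'
    have hxx : Real.exp (w q) = Real.exp (w q / 2) ^ 2 := by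
      rw [← Real.exp_nat_mul]; congr 1; push_cast; ring
    change _ ≤ y ^ 2 / 2 * 1 + m / (2 * y ^ 2) * (1 * Real.sqrt (h q).det)
    rw [H.sqrt_det hq, hxx]
    generalize Real.exp (w q / 2) = x at *
    generalize Real.sqrt (g q).det = r at *
    -- This is `x ≤ y²/2 + x²/(2y²)` for `x = e^(w/2)`, followed by `1 ≤ m √det g`, which turns `x²
    -- = eʷ` into the area density of `h`.
    have e1 : y ^ 2 / 2 * 1 + m / (2 * y ^ 2) * (1 * (x ^ 2 * r)) - x =
        (y ^ 2 - x) ^ 2 / (2 * y ^ 2) + x ^ 2 * (m * r - 1) / (2 * y ^ 2) := by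
      field_simp
      ring
    have e2 : 0 ≤ (y ^ 2 - x) ^ 2 / (2 * y ^ 2) := by positivity
    have e3 : 0 ≤ x ^ 2 * (m * r - 1) / (2 * y ^ 2) :=
      div_nonneg (mul_nonneg (sq_nonneg _) (by linarith)) (by positivity)
    linarith
  have step4 : bdryInt ρ (fun q => Real.exp (w q / 2)) ≤
      (((1 + area ρ g) / ρ + 1 / 4) / 2 * (cylInt ρ (fun _ => 1) + m) +
        l / 2 * totalScalarCurvature ρ g) * y := by
    have s3 := mul_le_mul_of_nonneg_left step3 (show 0 ≤ 1 / ρ + 1 / (4 * y) by positivity)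
    have e1 : (1 / ρ + 1 / (4 * y)) * (y ^ 2 / 2 * (cylInt ρ (fun _ => 1) + m)) =
        (y / ρ + 1 / 4) / 2 * (cylInt ρ (fun _ => 1) + m) * y := by
      field_simp
    have e2 : y / ρ ≤ (1 + area ρ g) / ρ := div_le_div_of_nonneg_right hy1 hρ.le
    have e3 : (y / ρ + 1 / 4) / 2 * (cylInt ρ (fun _ => 1) + m) * y ≤
        ((1 + area ρ g) / ρ + 1 / 4) / 2 * (cylInt ρ (fun _ => 1) + m) * y := by
      gcongr
    linarith
  calc totalScalarCurvature ρ h ≤ B * bdryInt ρ (fun q => Real.exp (w q / 2)) := step1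
    _ ≤ B * ((((1 + area ρ g) / ρ + 1 / 4) / 2 * (cylInt ρ (fun _ => 1) + m) +
        l / 2 * totalScalarCurvature ρ g) * y) := mul_le_mul_of_nonneg_left step4 hB.le
    _ = _ := by ring

/-! ### Area, scale invariance, and evolution of the integral quantities. -/

lemma IsSmoothMetric.area_pos {ρ : ℝ} {g : TensorField} (hρ : 0 < ρ) (hg : IsSmoothMetric ρ g) :
    0 < area ρ g := by
  obtain ⟨m, hm, hmb⟩ := exists_bound_of_periodic
    ((contDiffOn_const (c := (1 : ℝ))).div hg.contDiffOn_sqrt_det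
      fun q hq => (hg.sqrt_det_pos hq).ne').continuousOn
    (fun θ s hs => by simp only [Pi.div_apply, hg.periodic θ s hs])
  have h1 : cylInt ρ (fun _ => 1 / m) ≤ cylInt ρ (fun q => 1 * Real.sqrt (g q).det) := by
    refine cylInt_mono hρ continuousOn_const
      (continuousOn_const.mul hg.contDiffOn_sqrt_det.continuousOn) fun q hq => ?_
    have hm' : 1 / Real.sqrt (g q).det ≤ m := (le_abs_self _).trans (hmb q hq)
    change 1 / m ≤ 1 * Real.sqrt (g q).det
    rw [one_mul]
    rw [div_le_iff₀ (hg.sqrt_det_pos hq)] at hm'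
    rw [div_le_iff₀ hm]
    linarith
  refine lt_of_lt_of_le ?_ h1
  simp only [cylInt, intervalIntegral.integral_const, smul_eq_mul, sub_zero, sub_neg_eq_add]
  have := Real.pi_pos
  positivity

lemma area_congr {ρ : ℝ} (hρ : 0 < ρ) {g h : TensorField} (hgh : ∀ q ∈ strip ρ, g q = h q) :
    area ρ g = area ρ h :=
  cylInt_congr (f := fun q => 1 * Real.sqrt (g q).det) (h := fun q => 1 * Real.sqrt (h q).det) hρ
    fun q hq => by rw [hgh q hq]

lemma totalScalarCurvature_congr {ρ : ℝ} (hρ : 0 < ρ) {g h : TensorField}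
    (hgh : ∀ q ∈ strip ρ, g q = h q) : totalScalarCurvature ρ g = totalScalarCurvature ρ h :=
  cylInt_congr (f := fun q => scalarCurvature ρ g q * Real.sqrt (g q).det)
    (h := fun q => scalarCurvature ρ h q * Real.sqrt (h q).det) hρ
    fun q hq => by rw [hgh q hq, scalarCurvature_congr hgh hq]

/-- The total scalar curvature is invariant under scaling. -/
lemma totalScalarCurvature_smul {ρ : ℝ} (hρ : 0 < ρ) {g : TensorField} (hg : IsSmoothMetric ρ g)
    {c : ℝ} (hc : 0 < c) :
    totalScalarCurvature ρ (fun p => c • g p) = totalScalarCurvature ρ g := by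
  have H : IsConformal ρ (fun _ => Real.log c) g (fun p => c • g p) :=
    { smooth := contDiffOn_const
      left := hg
      right :=
        { smooth := fun i j => contDiffOn_const.mul (hg.smooth i j)
          periodic := fun θ s hs => by rw [hg.periodic θ s hs]
          posDef := fun p hp => (hg.posDef p hp).smul hc }
      eq := fun p _ => by rw [Real.exp_log hc] }
  have hgrad : ∀ i, ∀ q ∈ strip ρ, gradFlux ρ g (fun _ => Real.log c) i q = 0 := fun i q hq => by
    simp only [gradFlux, fun j => (HasPD.const (i := j) hρ hq (Real.log c)).2, mul_zero,
      Finset.sum_const_zero]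
  refine cylInt_congr (f := fun q => scalarCurvature ρ (fun p => c • g p) q *
    Real.sqrt ((fun p => c • g p) q).det)
    (h := fun q => scalarCurvature ρ g q * Real.sqrt (g q).det) hρ fun q hq => ?_
  rw [H.scalarCurvature_mul_sqrt_det hρ hq, pderiv_congr (hgrad 0) hq, pderiv_congr (hgrad 1) hq,
    (HasPD.const hρ hq 0).2, (HasPD.const hρ hq 0).2]
  ring

namespace IsRicciFlow

open MeasureTheory

variable {ρ : ℝ} {g₀ : TensorField} {T : EReal} {g : ℝ → TensorField}
  (H : IsRicciFlow ρ g₀ T g) (hρ : 0 < ρ)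

section
include H

lemma sqrt_det_eq {t : ℝ} (ht : 0 ≤ t) (htT : (t : EReal) < T) {p : ℝ × ℝ} (hp : p ∈ strip ρ) :
    Real.sqrt (g t p).det =
      Real.exp (Real.log (g t p 0 0) - Real.log (g 0 p 0 0)) * Real.sqrt (g 0 p).det :=
  (H.isConformal le_rfl H.pos ht htT).sqrt_det hp

lemma hasDerivAt_sqrt_det {t : ℝ} (ht : 0 < t) (htT : (t : EReal) < T) {p : ℝ × ℝ}
    (hp : p ∈ strip ρ) : HasDerivAt (fun s => 1 * Real.sqrt (g s p).det)
      (-(scalarCurvature ρ (g t) p * Real.sqrt (g t p).det)) t := by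
  obtain ⟨τ, htτ, hτT⟩ := EReal.lt_iff_exists_real_btwn.1 htT
  have htτ' : t < τ := EReal.coe_lt_coe_iff.1 htτ
  have h1 := (((H.hasDerivAt_log ht htT hp).sub_const (Real.log (g 0 p 0 0))).exp).mul_const
    (Real.sqrt (g 0 p).det)
  refine (h1.congr_of_eventuallyEq ?_).congr_deriv ?_
  · filter_upwards [Ioo_mem_nhds ht htτ'] with s hs
    rw [one_mul, H.sqrt_det_eq hs.1.le ((EReal.coe_lt_coe_iff.2 hs.2).trans hτT) hp]
  · rw [H.sqrt_det_eq ht.le htT hp]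
    ring

lemma continuousOn_sqrt_det {t : ℝ} (ht : 0 ≤ t) (htT : (t : EReal) < T) :
    ContinuousOn (fun q => 1 * Real.sqrt (g t q).det) (strip ρ) :=
  continuousOn_const.mul (H.metric t ht htT).contDiffOn_sqrt_det.continuousOn

include hρ

lemma area_eq_setIntegral {t : ℝ} (ht : 0 ≤ t) (htT : (t : EReal) < T) : area ρ (g t) =
    ∫ q in Set.Icc 0 (2 * Real.pi) ×ˢ Set.Icc (-ρ) ρ, 1 * Real.sqrt (g t q).det :=
  cylInt_eq (f := fun q => 1 * Real.sqrt (g t q).det) hρ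
    (continuousOn_const.mul (H.metric t ht htT).contDiffOn_sqrt_det.continuousOn)

variable (hR : ∀ p ∈ strip ρ, 0 ≤ scalarCurvature ρ g₀ p)
  (hk : ∀ p ∈ stripBoundary ρ, geodesicCurvature ρ g₀ p ≤ 0)

include hR hk

lemma sqrt_det_le {t : ℝ} (ht : 0 ≤ t) (htT : (t : EReal) < T) {p : ℝ × ℝ} (hp : p ∈ strip ρ) :
    Real.sqrt (g t p).det ≤ Real.sqrt (g 0 p).det := by
  rw [H.sqrt_det_eq ht htT hp]
  refine mul_le_of_le_one_left (Real.sqrt_nonneg _) (Real.exp_le_one_iff.2 ?_)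
  linarith [H.log_le_log_zero hρ hR hk ht htT hp]

lemma continuousOn_area {τ : ℝ} (hτT : (τ : EReal) < T) :
    ContinuousOn (fun t => area ρ (g t)) (Set.Icc 0 τ) := by
  have hlt : ∀ t ∈ Set.Icc 0 τ, (t : EReal) < T := fun t ht =>
    lt_of_le_of_lt (EReal.coe_le_coe_iff.2 ht.2) hτT
  have hmeas : MeasurableSet (Set.Icc 0 (2 * Real.pi) ×ˢ Set.Icc (-ρ) ρ) :=
    measurableSet_Icc.prod measurableSet_Icc
  refine ContinuousOn.congr (continuousOn_of_dominated
    (μ := volume.restrict (Set.Icc 0 (2 * Real.pi) ×ˢ Set.Icc (-ρ) ρ))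
    (F := fun t q => 1 * Real.sqrt (g t q).det) (bound := fun q => 1 * Real.sqrt (g 0 q).det)
    (fun t ht => ?_) (fun t ht => ?_) ?_ ?_) (fun t ht => H.area_eq_setIntegral hρ ht.1 (hlt t ht))
  · exact (integrableOn_rectangle (H.continuousOn_sqrt_det ht.1 (hlt t ht))).aestronglyMeasurable
  · refine (ae_restrict_iff' hmeas).2 (Filter.Eventually.of_forall fun q hq => ?_)
    rw [one_mul, one_mul, Real.norm_of_nonneg (Real.sqrt_nonneg _)]
    exact H.sqrt_det_le hρ hR hk ht.1 (hlt t ht) (rectangle_subset_strip ρ hq)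
  · exact integrableOn_rectangle (H.continuousOn_sqrt_det le_rfl H.pos)
  · refine (ae_restrict_iff' hmeas).2 (Filter.Eventually.of_forall fun q hq => ?_)
    have hqs := rectangle_subset_strip ρ hq
    have hL : ContinuousOn (fun t => Real.log (g t q 0 0)) (Set.Icc 0 τ) :=
      (H.continuousOn_log hτT).comp (f := fun t : ℝ => (t, q)) (by fun_prop)
        fun t ht => ⟨ht, hqs⟩
    refine ContinuousOn.congr (f := fun t =>
      Real.exp (Real.log (g t q 0 0) - Real.log (g 0 q 0 0)) * Real.sqrt (g 0 q).det) ?_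
      fun t ht => ?_
    · exact (hL.sub continuousOn_const).rexp.mul continuousOn_const
    · rw [one_mul, H.sqrt_det_eq ht.1 (hlt t ht) hqs]

/-- The area decreases at the rate of the total scalar curvature. -/
lemma hasDerivAt_area {t : ℝ} (ht : 0 < t) (htT : (t : EReal) < T) :
    HasDerivAt (fun s => area ρ (g s)) (-totalScalarCurvature ρ (g t)) t := by
  obtain ⟨τ, htτ, hτT⟩ := EReal.lt_iff_exists_real_btwn.1 htT
  have htτ' : t < τ := EReal.coe_lt_coe_iff.1 htτ
  have hlt : ∀ s ∈ Set.Ioo 0 τ, (s : EReal) < T := fun s hs =>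
    (EReal.coe_lt_coe_iff.2 hs.2).trans hτT
  obtain ⟨C, hC, hCb⟩ := H.exists_scalarCurvature_bound hρ hτT
  have hmeas : MeasurableSet (Set.Icc 0 (2 * Real.pi) ×ˢ Set.Icc (-ρ) ρ) :=
    measurableSet_Icc.prod measurableSet_Icc
  have hnhds : Set.Ioo 0 τ ∈ nhds t := Ioo_mem_nhds ht htτ'
  have hdens := (H.metric t ht.le htT).continuousOn_scalarCurvature_density hρ
  have key := (hasDerivAt_integral_of_dominated_loc_of_deriv_le
    (μ := volume.restrict (Set.Icc 0 (2 * Real.pi) ×ˢ Set.Icc (-ρ) ρ))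
    (F := fun t q => 1 * Real.sqrt (g t q).det)
    (F' := fun t q => -(scalarCurvature ρ (g t) q * Real.sqrt (g t q).det))
    (bound := fun q => C * (1 * Real.sqrt (g 0 q).det)) hnhds ?_ ?_ ?_ ?_ ?_ ?_).2
  · refine (key.congr_of_eventuallyEq ?_).congr_deriv ?_
    · filter_upwards [hnhds] with s hs
      exact H.area_eq_setIntegral hρ hs.1.le (hlt s hs)
    · rw [integral_neg, ← cylInt_eq hρ hdens]
      rfl
  · filter_upwards [hnhds] with s hs
    exact (integrableOn_rectangle
      (H.continuousOn_sqrt_det hs.1.le (hlt s hs))).aestronglyMeasurable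
  · exact integrableOn_rectangle (H.continuousOn_sqrt_det ht.le htT)
  · exact (integrableOn_rectangle hdens.neg).aestronglyMeasurable
  · refine (ae_restrict_iff' hmeas).2 (Filter.Eventually.of_forall fun q hq s hs => ?_)
    have hqs := rectangle_subset_strip ρ hq
    rw [norm_neg, norm_mul, one_mul, Real.norm_of_nonneg (Real.sqrt_nonneg _)]
    exact mul_le_mul (hCb s ⟨hs.1.le, hs.2.le⟩ q hqs)
      (H.sqrt_det_le hρ hR hk hs.1.le (hlt s hs) hqs) (Real.sqrt_nonneg _) hC
  · exact (integrableOn_rectangle (H.continuousOn_sqrt_det le_rfl H.pos)).const_mul C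
  · refine (ae_restrict_iff' hmeas).2 (Filter.Eventually.of_forall fun q hq s hs => ?_)
    exact H.hasDerivAt_sqrt_det hs.1 (hlt s hs) (rectangle_subset_strip ρ hq)

/-- Written over the initial metric, the boundary integrand is the fixed nonnegative weight `-2 k
√(g₀)₀₀` times `e^(w/2)`, and `w` decreases in time. -/
lemma totalScalarCurvature_antitone {s t : ℝ} (hs : 0 ≤ s) (hst : s ≤ t) (htT : (t : EReal) < T) :
    totalScalarCurvature ρ (g t) ≤ totalScalarCurvature ρ (g s) := by
  have hsT : (s : EReal) < T := lt_of_le_of_lt (EReal.coe_le_coe_iff.2 hst) htT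
  have ht := hs.trans hst
  have hkk {t : ℝ} (ht : 0 ≤ t) (htT : (t : EReal) < T) : ∀ q ∈ stripBoundary ρ,
      geodesicCurvature ρ (g t) q = geodesicCurvature ρ (g 0) q := fun q hq => by
    rw [H.geodesicCurvature_eq hρ ht htT hq, H.geodesicCurvature_eq hρ le_rfl H.pos hq]
  have Cs := H.isConformal le_rfl H.pos hs hsT
  have Ct := H.isConformal le_rfl H.pos ht htT
  have hm := H.metric 0 le_rfl H.pos
  have hflux := (hm.contDiffOn_curvatureFlux hρ 1).continuousOn
  have hsnd : ContinuousOn (fun q : ℝ × ℝ => q.2 / ρ) (strip ρ) := by fun_prop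
  rw [Ct.totalScalarCurvature_eq_of_eq hρ (hkk ht htT),
    Cs.totalScalarCurvature_eq_of_eq hρ (hkk hs hsT)]
  refine bdryInt_mono hρ ((hsnd.mul hflux).mul (Ct.smooth.div_const 2).exp.continuousOn)
    ((hsnd.mul hflux).mul (Cs.smooth.div_const 2).exp.continuousOn) fun q hq => ?_
  have hqs := stripBoundary_subset_strip hρ hq
  refine mul_le_mul_of_nonneg_left (Real.exp_le_exp.2 ?_) ?_
  · have := H.log_antitone hρ hR hk (t := s) (h := t - s) hs (by linarith) (by simpa using htT) hqs
    rw [add_sub_cancel] at this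
    linarith
  · rw [hm.div_mul_curvatureFlux hρ hq, H.geodesicCurvature_eq hρ le_rfl H.pos hq]
    have := mul_nonneg (neg_nonneg.2 (hk q hq)) (Real.sqrt_nonneg (g 0 q 0 0))
    linarith

/-- Decay of the area in terms of the rescaled time. -/
lemma area_le {τ : ℝ} (hτ : 0 ≤ τ) (hτT : (τ : EReal) < T) :
    area ρ (g τ) ≤ area ρ (g 0) *
      Real.exp (-(totalScalarCurvature ρ (g τ) * normalisedTime ρ g τ)) := by
  have hlt : ∀ t ∈ Set.Icc 0 τ, (t : EReal) < T := fun t ht =>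
    lt_of_le_of_lt (EReal.coe_le_coe_iff.2 ht.2) hτT
  have hpos : ∀ t ∈ Set.Icc 0 τ, 0 < area ρ (g t) := fun t ht =>
    (H.metric t ht.1 (hlt t ht)).area_pos hρ
  have hA := H.continuousOn_area hρ hR hk hτT
  have hφ : ContinuousOn (fun t => normalisingFactor ρ (g t)) (Set.Icc 0 τ) :=
    hA.inv₀ fun t ht => (hpos t ht).ne'
  have hφi : IntegrableOn (fun t => normalisingFactor ρ (g t)) (Set.uIcc 0 τ) := by
    rw [Set.uIcc_of_le hτ]; exact hφ.integrableOn_Icc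
  have htc : ContinuousOn (normalisedTime ρ g) (Set.Icc 0 τ) := by
    have := intervalIntegral.continuousOn_primitive_interval hφi
    rwa [Set.uIcc_of_le hτ] at this
  -- `F` is frozen at the final time, where it is smallest, so that `log A + F t` is nonincreasing
  -- on `[0, τ]`.
  set F := totalScalarCurvature ρ (g τ) with hF
  have hderiv : ∀ t ∈ Set.Ioo 0 τ, HasDerivAt
      (fun t => Real.log (area ρ (g t)) + F * normalisedTime ρ g t)
      (-totalScalarCurvature ρ (g t) / area ρ (g t) + F * (area ρ (g t))⁻¹) t := by
    intro t ht
    have ht' : t ∈ Set.Icc 0 τ := Set.Ioo_subset_Icc_self ht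
    have hn : Set.Icc 0 τ ∈ nhds t := Icc_mem_nhds ht.1 ht.2
    refine ((H.hasDerivAt_area hρ hR hk ht.1 (hlt t ht')).log (hpos t ht').ne').add
      (HasDerivAt.const_mul F ?_)
    refine intervalIntegral.integral_hasDerivAt_right ?_ ?_ (hφ.continuousAt hn)
    · refine ContinuousOn.intervalIntegrable ?_
      rw [Set.uIcc_of_le ht.1.le]
      exact hφ.mono (Set.Icc_subset_Icc_right ht.2.le)
    · exact (hφ.mono Set.Ioo_subset_Icc_self).stronglyMeasurableAtFilter isOpen_Ioo t ht
  have hanti : AntitoneOn (fun t => Real.log (area ρ (g t)) + F * normalisedTime ρ g t)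
      (Set.Icc 0 τ) := by
    refine antitoneOn_of_deriv_nonpos (convex_Icc _ _)
      ((hA.log fun t ht => (hpos t ht).ne').add (continuousOn_const.mul htc)) ?_ ?_
    · rw [interior_Icc]
      exact fun t ht => (hderiv t ht).differentiableAt.differentiableWithinAt
    · rw [interior_Icc]
      intro t ht
      have ht' : t ∈ Set.Icc 0 τ := Set.Ioo_subset_Icc_self ht
      rw [(hderiv t ht).deriv]
      have h1 := H.totalScalarCurvature_antitone hρ hR hk ht.1.le ht.2.le hτT
      have h2 : -totalScalarCurvature ρ (g t) / area ρ (g t) + F * (area ρ (g t))⁻¹ =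
          (F - totalScalarCurvature ρ (g t)) / area ρ (g t) := by ring
      rw [h2]
      exact div_nonpos_of_nonpos_of_nonneg (by linarith) (hpos t ht').le
  have h0 := hanti (Set.left_mem_Icc.2 hτ) (Set.right_mem_Icc.2 hτ) hτ
  have ht0 : normalisedTime ρ g 0 = 0 := intervalIntegral.integral_same
  simp only [ht0, mul_zero, add_zero] at h0
  rw [← Real.log_le_log_iff (hpos τ (Set.right_mem_Icc.2 hτ)) (mul_pos (hpos 0
    (Set.left_mem_Icc.2 hτ)) (Real.exp_pos _)), Real.log_mul (hpos 0 (Set.left_mem_Icc.2 hτ)).ne'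
    (Real.exp_pos _).ne', Real.log_exp]
  linarith

end

end IsRicciFlow

/-! ### Decay in the rescaled time. -/

lemma log_one_add_le_two_mul_sqrt {t : ℝ} (ht : 0 ≤ t) : Real.log (t + 1) ≤ 2 * Real.sqrt t := by
  have hs := Real.sqrt_nonneg t
  have h1 : t + 1 ≤ (Real.sqrt t + 1) ^ 2 := by nlinarith [Real.sq_sqrt ht]
  calc Real.log (t + 1) ≤ Real.log ((Real.sqrt t + 1) ^ 2) := Real.log_le_log (by linarith) h1
    _ = 2 * Real.log (Real.sqrt t + 1) := by rw [Real.log_pow]; norm_cast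
    _ ≤ 2 * Real.sqrt t := by
      have := Real.log_le_sub_one_of_pos (show 0 < Real.sqrt t + 1 by linarith)
      linarith

lemma exists_pow_four_eq {a : ℝ} (ha : 0 < a) : ∃ y, 0 < y ∧ y ^ 4 = a := by
  refine ⟨Real.sqrt (Real.sqrt a), by positivity, ?_⟩
  rw [show 4 = 2 * 2 from rfl, pow_mul, Real.sq_sqrt (Real.sqrt_nonneg _), Real.sq_sqrt ha.le]

/-- From `1 + x ≤ eˣ` one gets `F² t ≤ 4K`, that is `F √t ≤ 2 √K`, and `log(t + 1) ≤ 2 √t`. -/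
lemma mul_le_of_mul_exp_le {F t K : ℝ} (hF : 0 ≤ F) (ht : 0 ≤ t) (hK : 0 ≤ K)
    (h : F * Real.exp (F * t / 4) ≤ K) : F * Real.log (t + 1) ≤ 4 * Real.sqrt K := by
  have h1 := mul_le_mul_of_nonneg_left (Real.add_one_le_exp (F * t / 4)) hF
  have h2 : (F * Real.sqrt t) ^ 2 ≤ (2 * Real.sqrt K) ^ 2 := by
    rw [mul_pow, mul_pow, Real.sq_sqrt ht, Real.sq_sqrt hK]
    nlinarith
  have h3 := abs_le_of_sq_le_sq h2 (by positivity)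
  have h4 := mul_le_mul_of_nonneg_left (log_one_add_le_two_mul_sqrt ht) hF
  linarith [(abs_le.1 h3).1, le_abs_self (F * Real.sqrt t)]

/-- Decay of the total scalar curvature along the unnormalised flow, in the rescaled time. -/
lemma exists_totalScalarCurvature_decay {ρ : ℝ} (hρ : 0 < ρ) {g₀ : TensorField}
    (hg₀ : IsSmoothMetric ρ g₀) (hR : ∀ p ∈ strip ρ, 0 ≤ scalarCurvature ρ g₀ p)
    (hk : ∀ p ∈ stripBoundary ρ, geodesicCurvature ρ g₀ p ≤ 0) :
    ∃ c, 0 < c ∧ ∀ (T : EReal) (g : ℝ → TensorField), IsRicciFlow ρ g₀ T g →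
      ∀ τ : ℝ, 0 < τ → (τ : EReal) < T → 0 ≤ normalisedTime ρ g τ →
        totalScalarCurvature ρ (g τ) * Real.log (normalisedTime ρ g τ + 1) ≤ c := by
  obtain ⟨C, hC, hest⟩ := exists_totalScalarCurvature_le hρ hg₀ hR hk
  obtain ⟨y₀, hy₀, hy₀A⟩ := exists_pow_four_eq (hg₀.area_pos hρ)
  refine ⟨4 * Real.sqrt (C * y₀), by positivity, fun T g H τ hτ hτT ht => ?_⟩
  obtain ⟨y, hy, hyA⟩ := exists_pow_four_eq ((H.metric τ hτ.le hτT).area_pos hρ)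
  have hconf := H.isConformal le_rfl H.pos hτ.le hτT
  have hF := hest _ (g τ)
    { smooth := hconf.smooth
      left := hg₀
      right := hconf.right
      eq := fun p hp => by rw [← H.initial p hp]; exact hconf.eq p hp }
    (fun q hq => H.boundary τ hτ hτT q hq)
    (fun q hq => by linarith [H.log_le_log_zero hρ hR hk hτ.le hτT hq])
    (fun q hq => H.scalarCurvature_nonneg hρ hR hk hτ hτT hq) y hy hyA
  have hF0 : 0 ≤ totalScalarCurvature ρ (g τ) :=
    cylInt_nonneg (f := fun q => scalarCurvature ρ (g τ) q * Real.sqrt (g τ q).det) hρ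
      fun q hq => mul_nonneg (H.scalarCurvature_nonneg hρ hR hk hτ hτT hq) (Real.sqrt_nonneg _)
  have hA := H.area_le hρ hR hk hτ.le hτT
  rw [area_congr hρ H.initial, ← hyA, ← hy₀A] at hA
  generalize totalScalarCurvature ρ (g τ) = F at *
  generalize normalisedTime ρ g τ = t at *
  refine mul_le_of_mul_exp_le hF0 ht (by positivity) ?_
  -- The fourth root of the area decay, with `y⁴` and `y₀⁴` the areas at times `τ` and `0`.
  have hyy : y ≤ y₀ * Real.exp (-(F * t / 4)) := by
    refine le_of_pow_le_pow_left₀ (n := 4) (by norm_num) (by positivity) ?_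
    rw [mul_pow, ← Real.exp_nat_mul]
    refine hA.trans_eq ?_
    congr 2
    push_cast
    ring
  calc F * Real.exp (F * t / 4) ≤ C * y * Real.exp (F * t / 4) :=
        mul_le_mul_of_nonneg_right hF (Real.exp_pos _).le
    _ ≤ C * (y₀ * Real.exp (-(F * t / 4))) * Real.exp (F * t / 4) := by gcongr
    _ = C * y₀ := by rw [Real.exp_neg]; field_simp

end CylinderFlow

end

theorem mainTheorem3 (ρ : ℝ) (hρ : 0 < ρ) (g₀ : CylinderFlow.TensorField)
    (hg₀ : CylinderFlow.IsSmoothMetric ρ g₀)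
    (hR : ∀ p ∈ CylinderFlow.strip ρ, 0 ≤ CylinderFlow.scalarCurvature ρ g₀ p)
    (hk : ∀ p ∈ CylinderFlow.stripBoundary ρ, CylinderFlow.geodesicCurvature ρ g₀ p ≤ 0) :
    ∃ c : ℝ, 0 < c ∧
      ∀ (T : EReal) (g : ℝ → CylinderFlow.TensorField),
        CylinderFlow.IsNormalisedRicciFlow ρ g₀ T g →
        ∀ t : ℝ, 0 < t → (t : EReal) < T →
          CylinderFlow.totalScalarCurvature ρ (g t) ≤ c / Real.log (t + 1) := by
  obtain ⟨c, hc, hdecay⟩ := CylinderFlow.exists_totalScalarCurvature_decay hρ hg₀ hR hk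
  refine ⟨c, hc, ?_⟩
  rintro T g ⟨T', g', H, hscale, honto⟩ t ht htT
  obtain ⟨τ, hτ, hτT, rfl⟩ := honto t ht.le htT
  -- The boundary condition and `R ≥ 0` along the flow are available only at positive times; `t > 0`
  -- excludes `τ = 0`.
  have hτ0 : 0 < τ := by
    refine lt_of_le_of_ne hτ ?_
    rintro rfl
    exact absurd ht (by simp [CylinderFlow.normalisedTime])
  have hm := H.metric τ hτ hτT
  rw [CylinderFlow.totalScalarCurvature_congr hρ (hscale τ hτ hτT).2,
    CylinderFlow.totalScalarCurvature_smul hρ hm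
      (show 0 < CylinderFlow.normalisingFactor ρ (g' τ) from inv_pos.2 (hm.area_pos hρ)),
    le_div_iff₀ (Real.log_pos (by linarith))]
  exact hdecay T' g' H τ hτ0 hτT ht.le
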